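/- Fix a finite relational schema $\Sigma$, all of whose relation symbols have positive arity, and a Boolean query $q = p_1 \vee \dots \vee p_m$ over $\Sigma$, where each $p_i$ is an existentially closed conjunction of atoms $R(\bar t)$, negated atoms $\neg R(\bar t)$ and inequalities $t \neq t'$ (terms being variables or constants) such that every variable of a negated atom or inequality of $p_i$ also occurs in a positive atom of $p_i$ (a UCQ$^\neg$). For a database $D$ (a finite set of facts over $\Sigma$) with active domain $\mathrm{const}(D)$, put $$D^\pm = \{+f : f \in D\} \cup \{-R(\bar c) : R \in \Sigma,\ \bar c \in \mathrm{const}(D)^{\mathrm{arity}(R)},\ R(\bar c) \notin D\},$$ a database over the schema with symbols $+R$ and $-R$ for each $R\in\Sigma$. Let $q^\pm$ be obtained from $q$ by replacing each negated atom $\neg R(\bar t)$ by the atom $-R(\bar t)$ and each positive atom $R(\bar t)$ by $+R(\bar t)$, keeping the inequalities. A signed support of $q$ in $D$ is a set $S \subseteq D^\pm$ with $S \models q^\pm$, and a signed fact $\alpha$ is signed-relevant for $q$ in $D$ if it belongs to some inclusion-minimal signed support of $q$ in $D$. Then the following problem, for the fixed query $q$, is in (uniform) $\mathrm{AC}^0$: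 given a database $D$ and a signed fact $\alpha$, decide whether $\alpha$ is signed-relevant for $q$ in $D$. That is, constants being named by bit strings and an input being written as a word that lists $\alpha$ followed by the facts of $D$, the language of all words that encode a pair $(D,\alpha)$ with $\alpha$ signed-relevant for $q$ in $D$ is recognized by a family $(C_n)_{n \ge 0}$ of Boolean circuits (one for each word length $n$) with unbounded fan-in, constant depth and size polynomial in $n$. The family is moreover first-order uniform: gates are named by a tag from a fixed finite set and a fixed-length tuple of numbers in $\{0,\dots,n\}$, and the gates, labels, wires and output are definable by first-order formulas, independent of $n$, over $(\{0,\dots,n\}; \le, +, \times)$. -/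

import Mathlib

namespace SignedRelevance

/-! ### Schemas, facts and databases -/

/-- A relational schema: finitely many relation symbols, each of positive arity. -/
structure Schema where
  Rel : Type
  finite_rel : Finite Rel
  arity : Rel → ℕ
  arity_pos : ∀ R, 0 < arity R

/-- A relation symbol of `σ` applied to a tuple of elements of `T` of the right length. -/
structure RelApp (σ : Schema) (T : Type) where
  rel : σ.Rel
  args : Fin (σ.arity rel) → T

/-- Facts over the set `C` of constants. A database is a finite set of facts. -/
abbrev Fact (σ : Schema) (C : Type) : Type := RelApp σ C

/-- Variables. -/
abbrev Var : Type := ℕ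

/-- Terms: constants or variables. -/
inductive QTerm (C : Type) : Type
  | const (c : C)
  | var (x : Var)

/-- Relational atoms. -/
abbrev Atom (σ : Schema) (C : Type) : Type := RelApp σ (QTerm C)

/-- The value of a term under a valuation of the variables. -/
def QTerm.eval {C : Type} (ν : Var → C) : QTerm C → C
  | .const c => c
  | .var x => ν x

/-- The fact obtained from an atom by a valuation of the variables. -/
def groundAtom {σ : Schema} {C : Type} (ν : Var → C) (a : Atom σ C) : Fact σ C :=
  ⟨a.rel, fun i => (a.args i).eval ν⟩

/-- The variable `x` occurs in the atom `a`. -/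
def OccursIn {σ : Schema} {C : Type} (x : Var) (a : Atom σ C) : Prop :=
  ∃ i, a.args i = QTerm.var x

/-- The constants that occur in a set of facts. -/
def activeDomain {σ : Schema} {C : Type} (D : Set (Fact σ C)) : Set C :=
  {c | ∃ f ∈ D, ∃ i, f.args i = c}

/-! ### Queries -/

/-- A Boolean conjunctive query with safe negations and inequalities:
the existential closure of the conjunction of the atoms in `pos`, the negations of the atoms
in `neg`, and the inequalities `t ≠ t'` for `(t, t')` in `ineq`. -/
structure CQNeg (σ : Schema) (C : Type) where
  pos : List (Atom σ C)
  neg : List (Atom σ C)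
  ineq : List (QTerm C × QTerm C)
  safe_neg : ∀ a ∈ neg, ∀ x, OccursIn x a → ∃ b ∈ pos, OccursIn x b
  safe_ineq : ∀ e ∈ ineq, ∀ x, e.1 = QTerm.var x ∨ e.2 = QTerm.var x → ∃ b ∈ pos, OccursIn x b

/-- A finite union of such queries. -/
abbrev UCQNeg (σ : Schema) (C : Type) : Type := List (CQNeg σ C)

/-- `ν` is a satisfying assignment of `p` on the set `D` of facts. -/
def CQNeg.SatBy {σ : Schema} {C : Type} (p : CQNeg σ C) (D : Set (Fact σ C)) (ν : Var → C) :
    Prop :=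
  (∀ a ∈ p.pos, groundAtom ν a ∈ D) ∧
  (∀ a ∈ p.neg, groundAtom ν a ∉ D) ∧
  (∀ e ∈ p.ineq, e.1.eval ν ≠ e.2.eval ν)

/-- `D ⊨ q`. -/
def UCQNeg.Holds {σ : Schema} {C : Type} (q : UCQNeg σ C) (D : Set (Fact σ C)) : Prop :=
  ∃ p ∈ q, ∃ ν : Var → C, p.SatBy D ν

/-! ### Signed facts, signed supports, signed relevance -/

/-- The signed schema, with the symbols `+R = (true, R)` and `-R = (false, R)`. -/
def Schema.signed (σ : Schema) : Schema where
  Rel := Bool × σ.Rel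
  finite_rel := by
    have := σ.finite_rel
    infer_instance
  arity R := σ.arity R.2
  arity_pos R := σ.arity_pos R.2

/-- The signed atom or fact `+R(t)` (`s = true`) or `-R(t)` (`s = false`). -/
def withSign {σ : Schema} {T : Type} (s : Bool) (a : RelApp σ T) : RelApp σ.signed T :=
  ⟨(s, a.rel), a.args⟩

/-- Signed facts. -/
abbrev SignedFact (σ : Schema) (C : Type) : Type := Fact σ.signed C

/-- The signed database `D±`: the facts of `D` with a positive sign, and the facts outside `D`
over the active domain of `D` with a negative sign. -/
def signedDb {σ : Schema} {C : Type} (D : Finset (Fact σ C)) : Set (SignedFact σ C) :=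
  {α | ∃ f ∈ D, α = withSign true f} ∪
  {α | ∃ f : Fact σ C, (∀ i, f.args i ∈ activeDomain (D : Set (Fact σ C))) ∧ f ∉ D ∧
    α = withSign false f}

/-- The signed version of a conjunctive query: `R(t)` becomes `+R(t)`, and `¬ R(t)` becomes the
positive atom `-R(t)`; inequalities stay. -/
def CQNeg.signed {σ : Schema} {C : Type} (p : CQNeg σ C) : CQNeg σ.signed C where
  pos := p.pos.map (withSign true) ++ p.neg.map (withSign false)
  neg := []
  ineq := p.ineq
  safe_neg := by simp
  safe_ineq := by
    intro e he x hx
    obtain ⟨b, hb, i, hi⟩ := p.safe_ineq e he x hx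
    exact ⟨withSign true b, List.mem_append_left _ (List.mem_map_of_mem hb), i, hi⟩

/-- The signed version `q±` of `q`. -/
def UCQNeg.signed {σ : Schema} {C : Type} (q : UCQNeg σ C) : UCQNeg σ.signed C :=
  List.map CQNeg.signed q

/-- `S` is a signed support of `q` in `D`. -/
def IsSignedSupport {σ : Schema} {C : Type} (q : UCQNeg σ C) (D : Finset (Fact σ C))
    (S : Set (SignedFact σ C)) : Prop :=
  S ⊆ signedDb D ∧ UCQNeg.Holds (UCQNeg.signed q) S

/-- `α` is signed-relevant for `q` in `D`: it belongs to an inclusion-minimal signed support. -/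
def IsSignedRelevant {σ : Schema} {C : Type} (q : UCQNeg σ C) (D : Finset (Fact σ C))
    (α : SignedFact σ C) : Prop :=
  ∃ S : Set (SignedFact σ C), Minimal (IsSignedSupport q D) S ∧ α ∈ S

/-! ### Boolean circuits -/

/-- Gate labels of circuits reading words of length `n` over the alphabet `A`. An input gate
`input i a` tests whether the `i`-th letter is `a`. -/
inductive Label (A : Type) (n : ℕ) : Type
  | and
  | or
  | not
  | input (i : Fin n) (a : A)

/-- A circuit for words of length `n` over `A`: a finite acyclic graph of gates, with AND- and
OR-gates of arbitrary fan-in. `wire g h` says that the value of `h` is an input of `g`. -/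
structure Circuit (A : Type) (n : ℕ) where
  Gate : Type
  finite_gate : Finite Gate
  label : Gate → Label A n
  wire : Gate → Gate → Prop
  out : Gate
  acyclic : WellFounded (fun h g => wire g h)
  not_fanin : ∀ g, label g = Label.not → ∃! h, wire g h
  input_fanin : ∀ g i a, label g = Label.input i a → ∀ h, ¬ wire g h

/-- The truth value of a gate on the word `w`. -/
def Circuit.eval {A : Type} {n : ℕ} (c : Circuit A n) (w : Fin n → A) : c.Gate → Prop :=
  c.acyclic.fix fun g ih =>
    match c.label g with
    | Label.and => ∀ h, ∀ hw : c.wire g h, ih h hw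
    | Label.or => ∃ h, ∃ hw : c.wire g h, ih h hw
    | Label.not => ∃ h, ∃ hw : c.wire g h, ¬ ih h hw
    | Label.input i a => w i = a

/-- The circuit accepts the word `w`. -/
def Circuit.Accepts {A : Type} {n : ℕ} (c : Circuit A n) (w : Fin n → A) : Prop :=
  c.eval w c.out

/-- The number of gates. -/
noncomputable def Circuit.size {A : Type} {n : ℕ} (c : Circuit A n) : ℕ :=
  Nat.card c.Gate

/-- Every directed path has at most `d` wires, expressed by a height function that drops along
each wire. -/
def Circuit.DepthLE {A : Type} {n : ℕ} (c : Circuit A n) (d : ℕ) : Prop :=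
  ∃ height : c.Gate → ℕ, (∀ g h, c.wire g h → height h < height g) ∧ ∀ g, height g ≤ d

/-! ### First-order uniformity -/

/-- The relation symbols of bounded arithmetic: `x ≤ y`, `x + y = z` and `x * y = z`. -/
inductive NumRel : ℕ → Type
  | le : NumRel 2
  | add : NumRel 3
  | mul : NumRel 3

/-- The first-order language of bounded arithmetic. -/
def numLang : FirstOrder.Language := ⟨fun _ => Empty, NumRel⟩

/-- The numbers `0, …, n` with order and with addition and multiplication as relations. -/
instance numStructure (n : ℕ) : numLang.Structure (Fin (n + 1)) where
  funMap := fun f _ => Empty.elim f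
  RelMap := fun {_} r =>
    match r with
    | NumRel.le => fun v => (v 0 : ℕ) ≤ v 1
    | NumRel.add => fun v => (v 0 : ℕ) + v 1 = v 2
    | NumRel.mul => fun v => (v 0 : ℕ) * v 1 = v 2

/-- A relation on the numbers `0, …, n`, given for each `n`, is defined by one first-order
formula of bounded arithmetic for all `n`. -/
def UniformlyDefinable {ι : Type} (P : ∀ n : ℕ, (ι → Fin (n + 1)) → Prop) : Prop :=
  ∃ φ : numLang.Formula ι, ∀ (n : ℕ) (v : ι → Fin (n + 1)), φ.Realize v ↔ P n v

/-- First-order uniformity of a circuit family: the gates of the `n`-th circuit can be named by a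
tag from a fixed finite set and a tuple of fixed length of numbers `0, …, n`, in such a way that
the set of gates, the output gate, the labels and the wires are first-order definable in bounded
arithmetic. -/
def FOUniform {A : Type} (c : ∀ n : ℕ, Circuit A n) : Prop :=
  ∃ (t k : ℕ) (name : ∀ n, (c n).Gate → Fin t × (Fin k → Fin (n + 1))),
    (∀ n, Function.Injective (name n)) ∧
    (∀ τ, UniformlyDefinable fun n (v : Fin k → Fin (n + 1)) => ∃ g, name n g = (τ, v)) ∧
    (∀ τ, UniformlyDefinable fun n (v : Fin k → Fin (n + 1)) => name n (c n).out = (τ, v)) ∧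
    (∀ τ, UniformlyDefinable fun n (v : Fin k → Fin (n + 1)) =>
      ∃ g, name n g = (τ, v) ∧ (c n).label g = Label.and) ∧
    (∀ τ, UniformlyDefinable fun n (v : Fin k → Fin (n + 1)) =>
      ∃ g, name n g = (τ, v) ∧ (c n).label g = Label.or) ∧
    (∀ τ, UniformlyDefinable fun n (v : Fin k → Fin (n + 1)) =>
      ∃ g, name n g = (τ, v) ∧ (c n).label g = Label.not) ∧
    (∀ τ a, UniformlyDefinable fun n (v : Fin k ⊕ Unit → Fin (n + 1)) =>
      ∃ g i, name n g = (τ, fun j => v (Sum.inl j)) ∧ (c n).label g = Label.input i a ∧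
        (v (Sum.inr ()) : ℕ) = i) ∧
    (∀ τ τ', UniformlyDefinable fun n (v : Fin k ⊕ Fin k → Fin (n + 1)) =>
      ∃ g h, name n g = (τ, fun j => v (Sum.inl j)) ∧ name n h = (τ', fun j => v (Sum.inr j)) ∧
        (c n).wire g h)

/-- The class (uniform) AC⁰: languages recognized by a first-order uniform family of circuits of
constant depth and polynomial size, with gates of unbounded fan-in. -/
def InAC0 {A : Type} [Finite A] (L : Language A) : Prop :=
  ∃ c : ∀ n : ℕ, Circuit A n,
    (∃ d : ℕ, ∀ n, (c n).DepthLE d) ∧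
    (∃ p : Polynomial ℕ, ∀ n, (c n).size ≤ p.eval n) ∧
    FOUniform c ∧
    ∀ (n : ℕ) (w : Fin n → A), (c n).Accepts w ↔ List.ofFn w ∈ L

/-! ### The decision problem -/

/-- For the purpose of encoding inputs, constants are their names, which are bit strings. -/
abbrev Const : Type := List Bool

/-- The letters used to write down databases and signed facts. -/
inductive Letter (σ : Schema) : Type
  | bit (b : Bool)
  | sep
  | sign (s : Bool)
  | rel (R : σ.Rel)

instance (σ : Schema) : Finite (Letter σ) := by
  have := σ.finite_rel
  refine Finite.of_surjective
    (fun x : (Bool ⊕ Unit) ⊕ (Bool ⊕ σ.Rel) =>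
      match x with
      | Sum.inl (Sum.inl b) => Letter.bit b
      | Sum.inl (Sum.inr _) => Letter.sep
      | Sum.inr (Sum.inl s) => Letter.sign s
      | Sum.inr (Sum.inr R) => Letter.rel R) ?_
  rintro (b | _ | s | R)
  · exact ⟨Sum.inl (Sum.inl b), rfl⟩
  · exact ⟨Sum.inl (Sum.inr ()), rfl⟩
  · exact ⟨Sum.inr (Sum.inl s), rfl⟩
  · exact ⟨Sum.inr (Sum.inr R), rfl⟩

/-- A tuple of constants: each constant is written as a separator followed by its bits. -/
def encodeTuple (σ : Schema) {k : ℕ} (c : Fin k → Const) : List (Letter σ) :=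
  (List.ofFn c).flatMap fun b => Letter.sep :: b.map Letter.bit

/-- A fact: the relation symbol followed by the arguments. -/
def encodeFact {σ : Schema} (f : Fact σ Const) : List (Letter σ) :=
  Letter.rel f.rel :: encodeTuple σ f.args

/-- A signed fact: the sign, the relation symbol and the arguments. -/
def encodeSignedFact {σ : Schema} (α : SignedFact σ Const) : List (Letter σ) :=
  Letter.sign α.rel.1 :: Letter.rel α.rel.2 :: encodeTuple σ α.args

/-- `w` encodes the input `(D, α)`: it consists of `α`, followed by the facts of `D` listed in
some order (repetitions are harmless). -/
def Encodes {σ : Schema} (w : List (Letter σ)) (D : Finset (Fact σ Const))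
    (α : SignedFact σ Const) : Prop :=
  ∃ l : List (Fact σ Const), (∀ f, f ∈ l ↔ f ∈ D) ∧
    w = encodeSignedFact α ++ l.flatMap encodeFact

/-- The problem, for the fixed query `q`: given `D` and `α`, is `α` signed-relevant for `q`
in `D`? -/
def signedRelevanceProblem {σ : Schema} (q : UCQNeg σ Const) : Language (Letter σ) :=
  {w | ∃ (D : Finset (Fact σ Const)) (α : SignedFact σ Const),
    Encodes w D α ∧ IsSignedRelevant q D α}

end SignedRelevance

namespace SignedRelevance

/-! ### Arithmetically definable relations -/

namespace UniformlyDefinable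

variable {ι : Type}

/-! Two facts carry the proof. The first is logical: a language of words defined by one first-order
formula over positions, with letters and arithmetic as atoms, is in uniform AC⁰. The circuit has one
gate for each pair of a subformula and an assignment of its fixed number `K` of variables. Its depth
is the height of the formula, its size is a constant times `(n + 1) ^ K`, and since arithmetic atoms
are resolved in the labels, its description is itself arithmetically definable
(`Form.gateValue_iff_sat`, `Form.foUniform_circuit`). `Definable` is a variable-name-free calculus
for such relations, turned into actual formulas by `Definable.exists_form`.

The second is combinatorial. If an assignment ν satisfies the inequalities of a disjunct `p` and
maps all its signed atoms into a support `S`, then the image of `p` under ν is a support inside `S`.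
So a minimal support equals such an image, and an image inside D± is minimal exactly when no image
of any disjunct that satisfies its inequalities lies strictly inside it (`isSignedRelevant_iff`).
Since `q` is fixed, only boundedly many variables matter, and the condition has the form "some
assignment such that all assignments ...".

The link is that every constant of the active domain is written somewhere in the word, so
quantifying over constants becomes quantifying over positions from which constants are read.
Equality of constants is bitwise comparison at equal offsets, expressible with addition. A fact has
a number of arguments fixed by its symbol, so "this fact is written here" is first-order, and being
an encoding is a local condition: the prescribed beginning, and a complete fact at each relation
letter (`encodes_iff`). `mem_signedRelevanceProblem_iff` combines these into one first-order
condition. -/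

theorem congr {P Q : ∀ n : ℕ, (ι → Fin (n + 1)) → Prop} (hP : UniformlyDefinable P)
    (h : ∀ n v, P n v ↔ Q n v) : UniformlyDefinable Q := by
  obtain ⟨φ, hφ⟩ := hP
  exact ⟨φ, fun n v => (hφ n v).trans (h n v)⟩

theorem const (p : Prop) : UniformlyDefinable fun n (_ : ι → Fin (n + 1)) => p := by
  by_cases hp : p
  · exact ⟨⊤, fun n v => by simp [hp]⟩
  · exact ⟨⊥, fun n v => by simp [hp]⟩

theorem not {P : ∀ n : ℕ, (ι → Fin (n + 1)) → Prop} (hP : UniformlyDefinable P) :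
    UniformlyDefinable fun n v => ¬ P n v := by
  obtain ⟨φ, hφ⟩ := hP
  exact ⟨φ.not, fun n v => by simp [hφ]⟩

theorem and {P Q : ∀ n : ℕ, (ι → Fin (n + 1)) → Prop} (hP : UniformlyDefinable P)
    (hQ : UniformlyDefinable Q) : UniformlyDefinable fun n v => P n v ∧ Q n v := by
  obtain ⟨φ, hφ⟩ := hP
  obtain ⟨ψ, hψ⟩ := hQ
  exact ⟨φ ⊓ ψ, fun n v => by simp [hφ, hψ]⟩

theorem forall_fintype {β : Type} [Finite β] {P : β → ∀ n : ℕ, (ι → Fin (n + 1)) → Prop}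
    (hP : ∀ b, UniformlyDefinable (P b)) : UniformlyDefinable fun n v => ∀ b, P b n v := by
  choose φ hφ using hP
  exact ⟨FirstOrder.Language.Formula.iInf φ, fun n v => by simp [hφ]⟩

theorem comp {κ : Type} {P : ∀ n : ℕ, (ι → Fin (n + 1)) → Prop} (hP : UniformlyDefinable P)
    (f : ι → κ) : UniformlyDefinable fun n (v : κ → Fin (n + 1)) => P n (fun i => v (f i)) := by
  obtain ⟨φ, hφ⟩ := hP
  exact ⟨φ.relabel f, fun n v => by
    rw [FirstOrder.Language.Formula.realize_relabel, hφ]; rfl⟩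

theorem le (i j : ι) : UniformlyDefinable fun n (v : ι → Fin (n + 1)) => (v i : ℕ) ≤ v j := by
  refine ⟨FirstOrder.Language.Relations.formula (L := numLang) (n := 2) NumRel.le
    ![.var i, .var j], fun n v => ?_⟩
  exact FirstOrder.Language.Formula.realize_rel

theorem add (i j k : ι) :
    UniformlyDefinable fun n (v : ι → Fin (n + 1)) => (v i : ℕ) + v j = v k := by
  refine ⟨FirstOrder.Language.Relations.formula (L := numLang) (n := 3) NumRel.add
    ![.var i, .var j, .var k], fun n v => ?_⟩
  exact FirstOrder.Language.Formula.realize_rel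

theorem eq (i j : ι) : UniformlyDefinable fun n (v : ι → Fin (n + 1)) => v i = v j :=
  ((le i j).and (le j i)).congr fun n v => by
    rw [Fin.ext_iff]; omega

/-- In the naturals, `x + x = x` holds only for zero. -/
theorem eq_zero (i : ι) : UniformlyDefinable fun n (v : ι → Fin (n + 1)) => v i = 0 :=
  (add i i i).congr fun n v => by
    rw [Fin.ext_iff]; simp

/-- The bound `n` is not a constant of the language, but it is the largest element: a number is
below `n` exactly when it does not dominate everything. -/
theorem lt_last (i : ι) : UniformlyDefinable fun n (v : ι → Fin (n + 1)) => (v i : ℕ) < n := by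
  obtain ⟨φ, hφ⟩ := le (Sum.inr 0 : ι ⊕ Fin 1) (Sum.inl i)
  refine ⟨(FirstOrder.Language.Formula.iAlls (L := numLang) (Fin 1) φ).not, fun n v => ?_⟩
  rw [FirstOrder.Language.Formula.realize_not, FirstOrder.Language.Formula.realize_iAlls]
  simp only [hφ, Sum.elim_inr, Sum.elim_inl]
  constructor
  · intro h
    by_contra hn
    exact h fun u => by have := (u 0).2; omega
  · intro h hu
    have := hu fun _ => Fin.last n
    simp only [Fin.val_last] at this
    omega

end UniformlyDefinable

/-! ### First-order formulas over words -/

/-- First-order formulas about positions in words over `A`, with variables in `Fin K`. -/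
inductive Form (A : Type) (K : ℕ) : Type
  | arith (φ : numLang.Formula (Fin K))
  | letter (a : A) (i : Fin K)
  | not (f : Form A K)
  | and (f g : Form A K)
  | ex (i : Fin K) (f : Form A K)

namespace Form

variable {A : Type} {K : ℕ}

/-- Satisfaction of a formula in a word. -/
def Sat {n : ℕ} (w : Fin n → A) : Form A K → (Fin K → Fin (n + 1)) → Prop
  | arith φ, v => φ.Realize v
  | letter a i, v => ∃ h : (v i : ℕ) < n, w ⟨v i, h⟩ = a
  | not f, v => ¬ f.Sat w v
  | and f g, v => f.Sat w v ∧ g.Sat w v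
  | ex i f, v => ∃ x, f.Sat w (Function.update v i x)

/-- The nesting depth of a formula. -/
def height : Form A K → ℕ
  | arith _ => 0
  | letter _ _ => 0
  | not f => f.height + 1
  | and f g => f.height + g.height + 1
  | ex _ f => f.height + 1

/-- The immediate subformulas. -/
def children : Form A K → Set (Form A K)
  | arith _ => ∅
  | letter _ _ => ∅
  | not f => {f}
  | and f g => {f, g}
  | ex _ f => {f}

/-- The subformulas. -/
def subforms : Form A K → Set (Form A K)
  | arith φ => {arith φ}
  | letter a i => {letter a i}
  | not f => insert (not f) f.subforms
  | and f g => insert (and f g) (f.subforms ∪ g.subforms)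
  | ex i f => insert (ex i f) f.subforms

theorem finite_subforms (f : Form A K) : f.subforms.Finite := by
  induction f with
  | arith φ => exact Set.finite_singleton _
  | letter a i => exact Set.finite_singleton _
  | not f ih => exact ih.insert _
  | and f g ihf ihg => exact (ihf.union ihg).insert _
  | ex i f ih => exact ih.insert _

theorem self_mem_subforms (f : Form A K) : f ∈ f.subforms := by
  cases f <;> simp [subforms]

theorem children_subset_subforms {f g : Form A K} (h : g ∈ f.subforms) :
    g.children ⊆ f.subforms := by
  induction f with
  | arith φ => simp only [subforms, Set.mem_singleton_iff] at h; subst h; simp [children]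
  | letter a i => simp only [subforms, Set.mem_singleton_iff] at h; subst h; simp [children]
  | not f ih =>
    rcases h with rfl | h
    · simp [children, subforms, self_mem_subforms]
    · exact (ih h).trans (Set.subset_insert _ _)
  | and f₁ f₂ ih₁ ih₂ =>
    rcases h with rfl | h | h
    · simp [children, subforms, self_mem_subforms, Set.insert_subset_iff]
    · exact ((ih₁ h).trans Set.subset_union_left).trans (Set.subset_insert _ _)
    · exact ((ih₂ h).trans Set.subset_union_right).trans (Set.subset_insert _ _)
  | ex i f ih =>
    rcases h with rfl | h
    · simp [children, subforms, self_mem_subforms]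
    · exact (ih h).trans (Set.subset_insert _ _)

theorem height_lt_of_mem_children {f g : Form A K} (h : g ∈ f.children) :
    g.height < f.height := by
  cases f with
  | arith φ => exact h.elim
  | letter a i => exact h.elim
  | not f => obtain rfl := h; simp [height]
  | and f₁ f₂ => rcases h with rfl | rfl <;> simp only [height] <;> omega
  | ex i f => obtain rfl := h; simp [height]

theorem height_le_of_mem_subforms {f g : Form A K} (h : g ∈ f.subforms) :
    g.height ≤ f.height := by
  induction f with
  | arith φ => obtain rfl := h; rfl
  | letter a i => obtain rfl := h; rfl
  | not f ih =>
    rcases h with rfl | h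
    · rfl
    · have := ih h; simp only [height]; omega
  | and f₁ f₂ ih₁ ih₂ =>
    rcases h with rfl | h | h
    · rfl
    · have := ih₁ h; simp only [height]; omega
    · have := ih₂ h; simp only [height]; omega
  | ex i f ih =>
    rcases h with rfl | h
    · rfl
    · have := ih h; simp only [height]; omega

/-- The relation between the assignments at a gate and at a gate wired to it. -/
def Passes {n : ℕ} : Form A K → (Fin K → Fin (n + 1)) → (Fin K → Fin (n + 1)) → Prop
  | ex i _, v, u => ∀ j, j ≠ i → u j = v j
  | _, v, u => ∀ j, u j = v j

open Classical in
/-- The label of the gate of a formula and an assignment. -/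
noncomputable def gateLabel {n : ℕ} : Form A K → (Fin K → Fin (n + 1)) → Label A n
  -- Such a gate has no incoming wires. An empty AND is true and an empty OR is false, so the label
  -- alone stores the truth value; the same device makes a letter test past the end of the word
  -- false.
  | arith φ, v => if φ.Realize v then .and else .or
  | letter a i, v => if h : (v i : ℕ) < n then .input ⟨v i, h⟩ a else .or
  | not _, _ => .not
  | and _ _, _ => .and
  | ex _ _, _ => .or

/-- The circuit that evaluates a formula on words of length `n`. -/
noncomputable def circuit (f : Form A K) (n : ℕ) : Circuit A n where
  Gate := f.subforms × (Fin K → Fin (n + 1))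
  finite_gate := by
    have := f.finite_subforms.to_subtype
    infer_instance
  label g := g.1.1.gateLabel g.2
  wire g h := h.1.1 ∈ g.1.1.children ∧ g.1.1.Passes g.2 h.2
  out := (⟨f, f.self_mem_subforms⟩, 0)
  acyclic := Subrelation.wf (fun h => height_lt_of_mem_children h.1)
    (InvImage.wf (fun g : f.subforms × (Fin K → Fin (n + 1)) => g.1.1.height) wellFounded_lt)
  not_fanin := by
    rintro ⟨⟨g, hg⟩, v⟩ h
    cases g with
    | arith φ => simp only [gateLabel] at h; split_ifs at h
    | letter a i => simp only [gateLabel] at h; split_ifs at h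
    | and f₁ f₂ => simp [gateLabel] at h
    | ex i f₁ => simp [gateLabel] at h
    | not g =>
      refine ⟨(⟨g, children_subset_subforms hg rfl⟩, v), ⟨rfl, fun _ => rfl⟩, ?_⟩
      rintro ⟨⟨g', hg'⟩, u⟩ ⟨h₁, h₂⟩
      obtain rfl : g' = g := h₁
      obtain rfl : u = v := funext h₂
      rfl
  input_fanin := by
    rintro ⟨⟨g, hg⟩, v⟩ i a h ⟨g', u⟩ ⟨h₁, -⟩
    cases g with
    | arith φ => exact h₁
    | letter a i => exact h₁
    | not g => simp [gateLabel] at h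
    | and f₁ f₂ => simp [gateLabel] at h
    | ex i f₁ => simp [gateLabel] at h

end Form

/-! ### Correctness of the circuit of a formula -/

theorem Circuit.eval_iff {A : Type} {n : ℕ} (c : Circuit A n) (w : Fin n → A) (g : c.Gate) :
    c.eval w g ↔
      match c.label g with
      | Label.and => ∀ h, c.wire g h → c.eval w h
      | Label.or => ∃ h, c.wire g h ∧ c.eval w h
      | Label.not => ∃ h, c.wire g h ∧ ¬ c.eval w h
      | Label.input i a => w i = a := by
  conv_lhs => rw [Circuit.eval, WellFounded.fix_eq]
  generalize c.label g = l
  cases l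
  · exact Iff.rfl
  · exact exists_congr fun h => exists_prop
  · exact exists_congr fun h => exists_prop
  · exact Iff.rfl

namespace Form

variable {A : Type} {K : ℕ}

/-- The truth value of a gate of the circuit of a formula. -/
def gateValue (f : Form A K) {n : ℕ} (w : Fin n → A)
    (g : f.subforms × (Fin K → Fin (n + 1))) : Prop :=
  (f.circuit n).eval w g

/-- This is `Circuit.eval_iff` with the gate type, labels and wires of the circuit unfolded, so that
gates can be destructured as pairs. -/
theorem gateValue_iff (f : Form A K) {n : ℕ} (w : Fin n → A)
    (g : f.subforms × (Fin K → Fin (n + 1))) :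
    f.gateValue w g ↔
      match g.1.1.gateLabel g.2 with
      | Label.and => ∀ h : f.subforms × (Fin K → Fin (n + 1)),
          (h.1.1 ∈ g.1.1.children ∧ g.1.1.Passes g.2 h.2) → f.gateValue w h
      | Label.or => ∃ h : f.subforms × (Fin K → Fin (n + 1)),
          (h.1.1 ∈ g.1.1.children ∧ g.1.1.Passes g.2 h.2) ∧ f.gateValue w h
      | Label.not => ∃ h : f.subforms × (Fin K → Fin (n + 1)),
          (h.1.1 ∈ g.1.1.children ∧ g.1.1.Passes g.2 h.2) ∧ ¬ f.gateValue w h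
      | Label.input i a => w i = a :=
  (f.circuit n).eval_iff w g

theorem gateValue_iff_sat (f : Form A K) {n : ℕ} (w : Fin n → A) (g : Form A K) :
    ∀ (hg : g ∈ f.subforms) (v : Fin K → Fin (n + 1)),
      f.gateValue w (⟨g, hg⟩, v) ↔ g.Sat w v := by
  induction g with
  | arith φ =>
    intro hg v
    rw [gateValue_iff]
    by_cases h : φ.Realize v
    · simp [gateLabel, h, Sat, children]
    · simp [gateLabel, h, Sat, children]
  | letter a i =>
    intro hg v
    rw [gateValue_iff]
    by_cases h : (v i : ℕ) < n
    · simp [gateLabel, h, Sat]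
    · simp [gateLabel, h, Sat, children]
  | not g ih =>
    intro hg v
    rw [gateValue_iff]
    change (∃ h : f.subforms × (Fin K → Fin (n + 1)), (h.1.1 ∈ ({g} : Set (Form A K)) ∧
      ∀ j, h.2 j = v j) ∧ ¬ f.gateValue w h) ↔ ¬ g.Sat w v
    have hg' : g ∈ f.subforms := children_subset_subforms hg rfl
    rw [← ih hg' v]
    constructor
    · rintro ⟨⟨⟨g', _⟩, u⟩, ⟨h₁, h₂⟩, h⟩
      obtain rfl : g' = g := h₁
      obtain rfl : u = v := funext h₂
      exact h
    · exact fun h => ⟨(⟨g, hg'⟩, v), ⟨rfl, fun _ => rfl⟩, h⟩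
  | and g₁ g₂ ih₁ ih₂ =>
    intro hg v
    rw [gateValue_iff]
    change (∀ h : f.subforms × (Fin K → Fin (n + 1)), (h.1.1 ∈ ({g₁, g₂} : Set (Form A K)) ∧
      ∀ j, h.2 j = v j) → f.gateValue w h) ↔ g₁.Sat w v ∧ g₂.Sat w v
    have hg₁ : g₁ ∈ f.subforms := children_subset_subforms hg (Or.inl rfl)
    have hg₂ : g₂ ∈ f.subforms := children_subset_subforms hg (Or.inr rfl)
    rw [← ih₁ hg₁ v, ← ih₂ hg₂ v]
    constructor
    · exact fun h => ⟨h (⟨g₁, hg₁⟩, v) ⟨Or.inl rfl, fun _ => rfl⟩,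
        h (⟨g₂, hg₂⟩, v) ⟨Or.inr rfl, fun _ => rfl⟩⟩
    · rintro h ⟨⟨g', _⟩, u⟩ ⟨h₁, h₂⟩
      obtain rfl : u = v := funext h₂
      rcases h₁ with h₁ | h₁
      · obtain rfl : g' = g₁ := h₁
        exact h.1
      · obtain rfl : g' = g₂ := h₁
        exact h.2
  | ex i g ih =>
    intro hg v
    rw [gateValue_iff]
    change (∃ h : f.subforms × (Fin K → Fin (n + 1)), (h.1.1 ∈ ({g} : Set (Form A K)) ∧
      ∀ j, j ≠ i → h.2 j = v j) ∧ f.gateValue w h) ↔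
      ∃ x, g.Sat w (Function.update v i x)
    have hg' : g ∈ f.subforms := children_subset_subforms hg rfl
    constructor
    · rintro ⟨⟨⟨g', _⟩, u⟩, ⟨h₁, h₂⟩, h⟩
      obtain rfl : g' = g := h₁
      -- A gate wired to an `ex i` gate may differ from it only at variable `i`, so its value there
      -- is the quantified witness.
      refine ⟨u i, ?_⟩
      have : Function.update v i (u i) = u := by
        funext j
        by_cases hj : j = i
        · subst hj; simp
        · simpa [hj] using (h₂ j hj).symm
      rw [this]
      exact (ih hg' u).1 h
    · rintro ⟨x, hx⟩
      exact ⟨(⟨g, hg'⟩, Function.update v i x),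
        ⟨rfl, fun j hj => by simp [hj]⟩, (ih hg' _).2 hx⟩

/-! ### Uniformity of the circuit -/

theorem uniformlyDefinable_label_and (g : Form A K) :
    UniformlyDefinable fun n (v : Fin K → Fin (n + 1)) => g.gateLabel v = Label.and := by
  cases g with
  | arith φ => exact ⟨φ, fun n v => by simp [gateLabel]⟩
  | letter a i =>
    exact (UniformlyDefinable.const False).congr fun n v => by
      simp only [gateLabel]; split_ifs <;> simp
  | not g => exact (UniformlyDefinable.const False).congr fun n v => by simp [gateLabel]
  | and g₁ g₂ => exact (UniformlyDefinable.const True).congr fun n v => by simp [gateLabel]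
  | ex i g => exact (UniformlyDefinable.const False).congr fun n v => by simp [gateLabel]

theorem uniformlyDefinable_label_or (g : Form A K) :
    UniformlyDefinable fun n (v : Fin K → Fin (n + 1)) => g.gateLabel v = Label.or := by
  cases g with
  | arith φ => exact ⟨φ.not, fun n v => by simp [gateLabel]⟩
  | letter a i =>
    exact (UniformlyDefinable.lt_last i).not.congr fun n v => by
      simp only [gateLabel]; split_ifs with h <;> simp [h]
  | not g => exact (UniformlyDefinable.const False).congr fun n v => by simp [gateLabel]
  | and g₁ g₂ => exact (UniformlyDefinable.const False).congr fun n v => by simp [gateLabel]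
  | ex i g => exact (UniformlyDefinable.const True).congr fun n v => by simp [gateLabel]

theorem uniformlyDefinable_label_not (g : Form A K) :
    UniformlyDefinable fun n (v : Fin K → Fin (n + 1)) => g.gateLabel v = Label.not := by
  cases g with
  | arith φ =>
    exact (UniformlyDefinable.const False).congr fun n v => by
      simp only [gateLabel]; split_ifs <;> simp
  | letter a i =>
    exact (UniformlyDefinable.const False).congr fun n v => by
      simp only [gateLabel]; split_ifs <;> simp
  | not g => exact (UniformlyDefinable.const True).congr fun n v => by simp [gateLabel]
  | and g₁ g₂ => exact (UniformlyDefinable.const False).congr fun n v => by simp [gateLabel]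
  | ex i g => exact (UniformlyDefinable.const False).congr fun n v => by simp [gateLabel]

theorem uniformlyDefinable_label_input (g : Form A K) (a : A) :
    UniformlyDefinable fun n (v : Fin K ⊕ Unit → Fin (n + 1)) =>
      ∃ i, g.gateLabel (fun j => v (Sum.inl j)) = Label.input i a ∧
        (v (Sum.inr ()) : ℕ) = i := by
  cases g with
  | arith φ =>
    exact (UniformlyDefinable.const False).congr fun n v => by
      simp only [gateLabel]; split_ifs <;> simp
  | letter b i =>
    refine ((UniformlyDefinable.const (b = a)).and
      ((UniformlyDefinable.lt_last (Sum.inl i)).and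
        (UniformlyDefinable.eq (Sum.inr ()) (Sum.inl i)))).congr fun n v => ?_
    simp only [gateLabel]
    split_ifs with h
    · simp only [Label.input.injEq, h, true_and, Fin.ext_iff]
      constructor
      · rintro ⟨rfl, h'⟩
        exact ⟨⟨_, h⟩, ⟨rfl, rfl⟩, h'⟩
      · rintro ⟨j, ⟨h', rfl⟩, h''⟩
        exact ⟨rfl, h''.trans h'.symm⟩
    · simp [h]
  | not g => exact (UniformlyDefinable.const False).congr fun n v => by simp [gateLabel]
  | and g₁ g₂ => exact (UniformlyDefinable.const False).congr fun n v => by simp [gateLabel]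
  | ex i g => exact (UniformlyDefinable.const False).congr fun n v => by simp [gateLabel]

theorem uniformlyDefinable_passes (g : Form A K) :
    UniformlyDefinable fun n (v : Fin K ⊕ Fin K → Fin (n + 1)) =>
      g.Passes (fun j => v (Sum.inl j)) (fun j => v (Sum.inr j)) := by
  have key : UniformlyDefinable fun n (v : Fin K ⊕ Fin K → Fin (n + 1)) =>
      ∀ j : Fin K, v (Sum.inr j) = v (Sum.inl j) :=
    UniformlyDefinable.forall_fintype fun j => UniformlyDefinable.eq _ _
  cases g with
  | ex i g =>
    refine (UniformlyDefinable.forall_fintype (β := {j : Fin K // j ≠ i}) fun j =>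
      UniformlyDefinable.eq (Sum.inr j.1) (Sum.inl j.1)).congr fun n v => ?_
    simp [Passes]
  | arith φ => exact key
  | letter a i => exact key
  | not g => exact key
  | and g₁ g₂ => exact key

/-- The tag of a gate is the number of its subformula and the tuple is its assignment. For fixed
tags the syntactic part of each condition is a constant, independent of `n`, and only a condition on
assignments remains to be defined. -/
theorem foUniform_circuit (f : Form A K) : FOUniform f.circuit := by
  have := f.finite_subforms.to_subtype
  have := Fintype.ofFinite f.subforms
  let e := Fintype.equivFin f.subforms
  refine ⟨Fintype.card f.subforms, K, fun n g => (e g.1, g.2), ?_, ?_, ?_, ?_, ?_, ?_, ?_, ?_⟩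
  · rintro n ⟨g, v⟩ ⟨g', v'⟩ h
    obtain ⟨h₁, h₂⟩ := Prod.mk.inj h
    exact Prod.ext (e.injective h₁) h₂
  · intro τ
    exact (UniformlyDefinable.const True).congr fun n v =>
      ⟨fun _ => ⟨(e.symm τ, v), by simp⟩, fun _ => trivial⟩
  · intro τ
    refine ((UniformlyDefinable.const (e ⟨f, f.self_mem_subforms⟩ = τ)).and
      (UniformlyDefinable.forall_fintype fun j => UniformlyDefinable.eq_zero j)).congr
      fun n v => ?_
    simp only [circuit, Prod.mk.injEq, funext_iff, Pi.zero_apply, eq_comm (a := (0 : Fin (n + 1)))]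
  · intro τ
    refine (uniformlyDefinable_label_and (e.symm τ).1).congr fun n v => ⟨fun h =>
      ⟨(e.symm τ, v), by simp, h⟩, ?_⟩
    rintro ⟨⟨g, u⟩, h, h'⟩
    obtain ⟨rfl, rfl⟩ := Prod.mk.inj h
    rw [e.symm_apply_apply]
    exact h'
  · intro τ
    refine (uniformlyDefinable_label_or (e.symm τ).1).congr fun n v => ⟨fun h =>
      ⟨(e.symm τ, v), by simp, h⟩, ?_⟩
    rintro ⟨⟨g, u⟩, h, h'⟩
    obtain ⟨rfl, rfl⟩ := Prod.mk.inj h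
    rw [e.symm_apply_apply]
    exact h'
  · intro τ
    refine (uniformlyDefinable_label_not (e.symm τ).1).congr fun n v => ⟨fun h =>
      ⟨(e.symm τ, v), by simp, h⟩, ?_⟩
    rintro ⟨⟨g, u⟩, h, h'⟩
    obtain ⟨rfl, rfl⟩ := Prod.mk.inj h
    rw [e.symm_apply_apply]
    exact h'
  · intro τ a
    refine (uniformlyDefinable_label_input (e.symm τ).1 a).congr fun n v => ⟨?_, ?_⟩
    · rintro ⟨i, h, h'⟩
      exact ⟨(e.symm τ, _), i, by simp, h, h'⟩
    · rintro ⟨⟨g, u⟩, i, h, h', h''⟩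
      obtain ⟨rfl, rfl⟩ := Prod.mk.inj h
      rw [e.symm_apply_apply]
      exact ⟨i, h', h''⟩
  · intro τ τ'
    refine ((UniformlyDefinable.const ((e.symm τ').1 ∈ (e.symm τ).1.children)).and
      (uniformlyDefinable_passes (e.symm τ).1)).congr fun n v => ⟨?_, ?_⟩
    · rintro ⟨h, h'⟩
      exact ⟨(e.symm τ, _), (e.symm τ', _), by simp, by simp, h, h'⟩
    · rintro ⟨⟨g, u⟩, ⟨g', u'⟩, h, h', h''⟩
      obtain ⟨rfl, rfl⟩ := Prod.mk.inj h
      obtain ⟨rfl, rfl⟩ := Prod.mk.inj h'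
      rw [e.symm_apply_apply, e.symm_apply_apply]
      exact h''

theorem inAC0 [Finite A] (f : Form A K) {L : Language A}
    (h : ∀ (n : ℕ) (w : Fin n → A), f.Sat w 0 ↔ List.ofFn w ∈ L) : InAC0 L := by
  refine ⟨f.circuit, ⟨f.height, fun n => ⟨fun g => g.1.1.height,
    fun g g' hw => height_lt_of_mem_children hw.1,
    fun g => height_le_of_mem_subforms g.1.2⟩⟩,
    ⟨Polynomial.C (Nat.card f.subforms) * (Polynomial.X + 1) ^ K, fun n => ?_⟩,
    f.foUniform_circuit, fun n w => ?_⟩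
  · have : (f.circuit n).size = Nat.card (f.subforms × (Fin K → Fin (n + 1))) := rfl
    rw [this, Nat.card_prod]
    simp
  · rw [← h]
    exact f.gateValue_iff_sat w f f.self_mem_subforms 0

end Form

/-! ### Definable relations on words -/

/-- First-order definability of relations between positions of words. -/
inductive Definable {A : Type} : {ι : Type} →
    (∀ n : ℕ, (Fin n → A) → (ι → Fin (n + 1)) → Prop) → Prop
  | arith {ι : Type} {P : ∀ n : ℕ, (ι → Fin (n + 1)) → Prop} (hP : UniformlyDefinable P) :
      Definable fun n _ v => P n v
  | letter {ι : Type} (a : A) (i : ι) :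
      Definable fun n w v => ∃ h : (v i : ℕ) < n, w ⟨v i, h⟩ = a
  | not {ι : Type} {P : ∀ n : ℕ, (Fin n → A) → (ι → Fin (n + 1)) → Prop} (hP : Definable P) :
      Definable fun n w v => ¬ P n w v
  | and {ι : Type} {P Q : ∀ n : ℕ, (Fin n → A) → (ι → Fin (n + 1)) → Prop} (hP : Definable P)
      (hQ : Definable Q) : Definable fun n w v => P n w v ∧ Q n w v
  | exOption {ι : Type} {P : ∀ n : ℕ, (Fin n → A) → (Option ι → Fin (n + 1)) → Prop}
      (hP : Definable P) : Definable fun n w v => ∃ x, P n w (fun o => o.elim x v)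

namespace Definable

variable {A ι : Type}

/-- Variables get numbers: those free so far lie below `m`, and a quantifier takes the fresh number
`m`. A conjunction needs the same `K` on both sides, so the claim is made for all `K` beyond a
threshold, which is chosen before the numbering `g`. -/
theorem exists_form {P : ∀ n : ℕ, (Fin n → A) → (ι → Fin (n + 1)) → Prop} (hP : Definable P) :
    ∀ m : ℕ, ∃ K₀, m ≤ K₀ ∧ ∀ K, K₀ ≤ K → ∀ g : ι → Fin K, (∀ i, (g i : ℕ) < m) →
      ∃ f : Form A K, ∀ (n : ℕ) (w : Fin n → A) v, f.Sat w v ↔ P n w (fun i => v (g i)) := by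
  induction hP with
  | arith hP =>
    intro m
    refine ⟨m, le_rfl, fun K _ g _ => ?_⟩
    obtain ⟨φ, hφ⟩ := hP.comp g
    exact ⟨.arith φ, fun n w v => hφ n v⟩
  | letter a i => exact fun m => ⟨m, le_rfl, fun K _ g _ => ⟨.letter a (g i), fun n w v => Iff.rfl⟩⟩
  | not _ ih =>
    intro m
    obtain ⟨K₀, h₀, h⟩ := ih m
    refine ⟨K₀, h₀, fun K hK g hg => ?_⟩
    obtain ⟨f, hf⟩ := h K hK g hg
    exact ⟨.not f, fun n w v => not_congr (hf n w v)⟩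
  | and _ _ ih₁ ih₂ =>
    intro m
    obtain ⟨K₁, h₁, h₁'⟩ := ih₁ m
    obtain ⟨K₂, h₂, h₂'⟩ := ih₂ m
    refine ⟨max K₁ K₂, by omega, fun K hK g hg => ?_⟩
    obtain ⟨f₁, hf₁⟩ := h₁' K (by omega) g hg
    obtain ⟨f₂, hf₂⟩ := h₂' K (by omega) g hg
    exact ⟨.and f₁ f₂, fun n w v => and_congr (hf₁ n w v) (hf₂ n w v)⟩
  | exOption _ ih =>
    intro m
    obtain ⟨K₀, h₀, h⟩ := ih (m + 1)
    refine ⟨K₀, by omega, fun K hK g hg => ?_⟩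
    have hm : m < K := by omega
    obtain ⟨f, hf⟩ := h K hK (fun o => o.elim ⟨m, hm⟩ g) (by
      rintro (_ | i)
      · simp
      · exact (hg i).trans (Nat.lt_succ_self m))
    refine ⟨.ex ⟨m, hm⟩ f, fun n w v => exists_congr fun x => (hf n w _).trans ?_⟩
    have : (fun i : Option _ => Function.update v ⟨m, hm⟩ x (i.elim ⟨m, hm⟩ g)) =
        fun o => o.elim x fun i => v (g i) := by
      funext o
      rcases o with _ | i
      · simp
      -- Numbers in use are below `m`, so rebinding `m` does not disturb them.
      · have : g i ≠ ⟨m, hm⟩ := fun h => by have := hg i; rw [h] at this; simp at this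
        simp [this]
    rw [this]

theorem inAC0 [Finite A] {L : Language A}
    (h : Definable fun n (w : Fin n → A) (_ : Empty → Fin (n + 1)) => List.ofFn w ∈ L) :
    InAC0 L := by
  obtain ⟨K, -, hK⟩ := h.exists_form 0
  obtain ⟨f, hf⟩ := hK K le_rfl Empty.elim (fun i => i.elim)
  exact f.inAC0 fun n w => hf n w 0

/-! ### Closure properties of definable relations -/

theorem congr {P Q : ∀ n : ℕ, (Fin n → A) → (ι → Fin (n + 1)) → Prop} (hP : Definable P)
    (h : ∀ n w v, P n w v ↔ Q n w v) : Definable Q := by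
  have : P = Q := by
    funext n w v
    exact propext (h n w v)
  exact this ▸ hP

theorem comp {κ : Type} {P : ∀ n : ℕ, (Fin n → A) → (ι → Fin (n + 1)) → Prop}
    (hP : Definable P) (f : ι → κ) :
    Definable fun n w (v : κ → Fin (n + 1)) => P n w (fun i => v (f i)) := by
  induction hP generalizing κ with
  | arith hP => exact .arith (hP.comp f)
  | letter a i => exact .letter a (f i)
  | not _ ih => exact .not (ih f)
  | and _ _ ih₁ ih₂ => exact .and (ih₁ f) (ih₂ f)
  | exOption _ ih =>
    refine (exOption (ih (Option.map f))).congr fun n w v => exists_congr fun x => ?_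
    have : (fun i : Option _ => (Option.map f i).elim x v) =
        fun o => o.elim x fun i => v (f i) := by
      funext o
      cases o <;> rfl
    rw [this]

theorem ex {P : ∀ n : ℕ, (Fin n → A) → (ι → Fin (n + 1)) → Fin (n + 1) → Prop}
    (hP : Definable fun n w (v : Option ι → Fin (n + 1)) =>
      P n w (fun i => v (some i)) (v none)) :
    Definable fun n w v => ∃ x, P n w v x :=
  hP.exOption

theorem all {P : ∀ n : ℕ, (Fin n → A) → (ι → Fin (n + 1)) → Fin (n + 1) → Prop}
    (hP : Definable fun n w (v : Option ι → Fin (n + 1)) =>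
      P n w (fun i => v (some i)) (v none)) :
    Definable fun n w v => ∀ x, P n w v x :=
  hP.not.exOption.not.congr fun n w v => by simp

/-- The tuple length does not depend on `n`, so this is an iteration of single quantifiers,
splitting off the first entry each time. -/
theorem exTuple {k : ℕ} {P : ∀ n : ℕ, (Fin n → A) → (ι → Fin (n + 1)) →
      (Fin k → Fin (n + 1)) → Prop}
    (hP : Definable fun n w (v : ι ⊕ Fin k → Fin (n + 1)) =>
      P n w (fun i => v (Sum.inl i)) (fun j => v (Sum.inr j))) :
    Definable fun n w v => ∃ u, P n w v u := by
  induction k generalizing ι with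
  | zero =>
    refine (hP.comp (Sum.elim id Fin.elim0)).congr fun n w v => ?_
    constructor
    · exact fun h => ⟨_, h⟩
    · rintro ⟨u, h⟩
      obtain rfl : u = fun j => j.elim0 := Subsingleton.elim _ _
      exact (iff_of_eq (congrArg _ (Subsingleton.elim _ _))).1 h
  | succ k ih =>
    have h := @ih (Option ι) (fun n w v u => P n w (fun i => v (some i)) (Fin.cons (v none) u))
      ((hP.comp (Sum.elim (fun i => Sum.inl (some i))
        (Fin.cons (Sum.inl none) fun j => Sum.inr j))).congr fun n w v => by
          apply iff_of_eq
          congr 1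
          funext j
          refine Fin.cases ?_ (fun j => ?_) j <;> simp)
    refine h.exOption.congr fun n w v => ?_
    constructor
    · rintro ⟨x, u, h⟩
      exact ⟨_, h⟩
    · rintro ⟨u, h⟩
      exact ⟨u 0, Fin.tail u, by simpa using h⟩

theorem allTuple {k : ℕ} {P : ∀ n : ℕ, (Fin n → A) → (ι → Fin (n + 1)) →
      (Fin k → Fin (n + 1)) → Prop}
    (hP : Definable fun n w (v : ι ⊕ Fin k → Fin (n + 1)) =>
      P n w (fun i => v (Sum.inl i)) (fun j => v (Sum.inr j))) :
    Definable fun n w v => ∀ u, P n w v u :=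
  (exTuple (P := fun n w v u => ¬ P n w v u) hP.not).not.congr fun n w v => by simp

theorem const (p : Prop) : Definable fun n (_ : Fin n → A) (_ : ι → Fin (n + 1)) => p :=
  .arith (.const p)

variable {P Q : ∀ n : ℕ, (Fin n → A) → (ι → Fin (n + 1)) → Prop}

theorem or (hP : Definable P) (hQ : Definable Q) : Definable fun n w v => P n w v ∨ Q n w v :=
  (hP.not.and hQ.not).not.congr fun n w v => by tauto

theorem imp (hP : Definable P) (hQ : Definable Q) : Definable fun n w v => P n w v → Q n w v :=
  (hP.and hQ.not).not.congr fun n w v => by tauto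

theorem iff (hP : Definable P) (hQ : Definable Q) :
    Definable fun n w v => (P n w v ↔ Q n w v) :=
  ((hP.imp hQ).and (hQ.imp hP)).congr fun n w v => by tauto

theorem existsMem {β : Type} (l : List β)
    {P : β → ∀ n : ℕ, (Fin n → A) → (ι → Fin (n + 1)) → Prop} (hP : ∀ b, Definable (P b)) :
    Definable fun n w v => ∃ b ∈ l, P b n w v := by
  induction l with
  | nil => exact (const False).congr fun n w v => by simp
  | cons b l ih => exact ((hP b).or ih).congr fun n w v => by simp

theorem forallMem {β : Type} (l : List β)
    {P : β → ∀ n : ℕ, (Fin n → A) → (ι → Fin (n + 1)) → Prop} (hP : ∀ b, Definable (P b)) :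
    Definable fun n w v => ∀ b ∈ l, P b n w v :=
  (existsMem l fun b => (hP b).not).not.congr fun n w v => by simp

theorem existsFinite {β : Type} [Finite β]
    {P : β → ∀ n : ℕ, (Fin n → A) → (ι → Fin (n + 1)) → Prop} (hP : ∀ b, Definable (P b)) :
    Definable fun n w v => ∃ b, P b n w v := by
  have := Fintype.ofFinite β
  exact (existsMem Finset.univ.toList hP).congr fun n w v => by simp

theorem forallFinite {β : Type} [Finite β]
    {P : β → ∀ n : ℕ, (Fin n → A) → (ι → Fin (n + 1)) → Prop} (hP : ∀ b, Definable (P b)) :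
    Definable fun n w v => ∀ b, P b n w v := by
  have := Fintype.ofFinite β
  exact (forallMem Finset.univ.toList hP).congr fun n w v => by simp

/-! ### Arithmetic and letters at positions -/

theorem le (i j : ι) : Definable fun n (_ : Fin n → A) v => (v i : ℕ) ≤ v j :=
  .arith (.le i j)

theorem lt (i j : ι) : Definable fun n (_ : Fin n → A) v => (v i : ℕ) < v j :=
  (le j i).not.congr fun n w v => by omega

theorem add (i j k : ι) : Definable fun n (_ : Fin n → A) v => (v i : ℕ) + v j = v k :=
  .arith (.add i j k)

/-- A successor is a larger number with nothing strictly between. -/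
theorem eqSucc (i j : ι) : Definable fun n (_ : Fin n → A) v => (v i : ℕ) = v j + 1 := by
  refine ((lt j i).and (ex (P := fun n w v x => (v j : ℕ) < x ∧ (x : ℕ) < v i)
    ((lt (some j) none).and (lt none (some i)))).not).congr fun n w v => ?_
  constructor
  · rintro ⟨h, h'⟩
    by_contra hne
    exact h' ⟨⟨v j + 1, by have := (v i).2; omega⟩, by simp, by simp; omega⟩
  · rintro h
    refine ⟨by omega, ?_⟩
    rintro ⟨x, h₁, h₂⟩
    omega

theorem eqConst (i : ι) (c : ℕ) : Definable fun n (_ : Fin n → A) v => (v i : ℕ) = c := by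
  induction c generalizing ι with
  | zero => exact (add i i i).congr fun n w v => by simp
  | succ c ih =>
    refine (ex (P := fun n w v x => (v i : ℕ) = x + 1 ∧ (x : ℕ) = c)
      ((eqSucc (some i) none).and (ih none))).congr fun n w v => ?_
    constructor
    · rintro ⟨x, h, h'⟩
      omega
    · intro h
      exact ⟨⟨c, by have := (v i).2; omega⟩, by simpa using h, rfl⟩

theorem getElem? (a : A) (i : ι) :
    Definable fun _ w v => (List.ofFn w)[(v i : ℕ)]? = some a :=
  (letter a i).congr fun n w v => by
    simp

theorem getElem?_const (a : A) (c : ℕ) :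
    Definable fun n (w : Fin n → A) (_ : ι → Fin (n + 1)) => (List.ofFn w)[c]? = some a := by
  refine (ex (P := fun n w v x => (x : ℕ) = c ∧ (List.ofFn w)[(x : ℕ)]? = some a)
    ((eqConst none c).and (getElem? a none))).congr fun n w v => ?_
  constructor
  · rintro ⟨x, rfl, h⟩
    exact h
  · intro h
    have hc : c < n := by simpa using (List.getElem?_eq_some_iff.1 h).1
    exact ⟨⟨c, by omega⟩, rfl, h⟩

end Definable

/-! ### Reading encoded databases -/

variable {σ : Schema}

/-- The longest bit string with which a word begins. -/
def leadingBits : List (Letter σ) → Const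
  | Letter.bit b :: l => b :: leadingBits l
  | _ => []

/-- The constant read from position `x` on. -/
def constAt (l : List (Letter σ)) (x : ℕ) : Const :=
  leadingBits (l.drop x)

theorem constAt_eq_cons (l : List (Letter σ)) (x : ℕ) (b : Bool) (c : Const) :
    constAt l x = b :: c ↔ l[x]? = some (Letter.bit b) ∧ constAt l (x + 1) = c := by
  unfold constAt
  by_cases hx : x < l.length
  · rw [List.drop_eq_getElem_cons hx, List.getElem?_eq_getElem hx]
    cases l[x] <;> simp [leadingBits]
  · rw [List.drop_eq_nil_of_le (by omega), List.getElem?_eq_none (by omega)]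
    simp [leadingBits]

theorem constAt_eq_nil (l : List (Letter σ)) (x : ℕ) :
    constAt l x = [] ↔ ∀ b, l[x]? ≠ some (Letter.bit b) := by
  constructor
  · intro h b hb
    have := (constAt_eq_cons l x b _).2 ⟨hb, rfl⟩
    simp [h] at this
  · intro h
    rcases hc : constAt l x with _ | ⟨b, c⟩
    · rfl
    · exact absurd ((constAt_eq_cons l x b c).1 hc).1 (h b)

theorem length_leadingBits_le (l : List (Letter σ)) : (leadingBits l).length ≤ l.length := by
  induction l with
  | nil => simp [leadingBits]
  | cons a l ih => cases a <;> simp [leadingBits, ih]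

theorem map_leadingBits_append_drop (l : List (Letter σ)) :
    (leadingBits l).map Letter.bit ++ l.drop (leadingBits l).length = l := by
  induction l with
  | nil => simp [leadingBits]
  | cons a l ih => cases a <;> simp [leadingBits, ih]

theorem leadingBits_map_append (c : Const) (l : List (Letter σ)) (hl : leadingBits l = []) :
    leadingBits (c.map Letter.bit ++ l) = c := by
  induction c with
  | nil => simpa using hl
  | cons b c ih => simp [leadingBits, ih]

/-- The recursive reading of a bit string becomes a bounded-quantifier condition: the bit at offset
`d` is read exactly when no non-bit letter interrupts the run before it. -/
theorem getElem?_constAt (l : List (Letter σ)) (x d : ℕ) (b : Bool) :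
    (constAt l x)[d]? = some b ↔
      (∀ e, x ≤ e → e < x + d → ∃ b', l[e]? = some (Letter.bit b')) ∧
        l[x + d]? = some (Letter.bit b) := by
  induction d generalizing x with
  | zero =>
    rcases hc : constAt l x with _ | ⟨b', c⟩
    · simpa using fun _ => (constAt_eq_nil l x).1 hc b
    · have := ((constAt_eq_cons l x b' c).1 hc).1
      simp only [List.getElem?_cons_zero, Nat.add_zero, this, Option.some.injEq, Letter.bit.injEq]
      exact ⟨fun h => ⟨fun e h₁ h₂ => by omega, h⟩, fun h => h.2⟩
  | succ d ih =>
    rcases hc : constAt l x with _ | ⟨b', c⟩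
    · simp only [List.getElem?_nil, reduceCtorEq, false_iff]
      rintro ⟨h, -⟩
      obtain ⟨b', hb'⟩ := h x le_rfl (by omega)
      exact (constAt_eq_nil l x).1 hc b' hb'
    · obtain ⟨h₁, rfl⟩ := (constAt_eq_cons l x b' c).1 hc
      rw [List.getElem?_cons_succ, ih, show x + 1 + d = x + (d + 1) by omega]
      refine and_congr_left fun _ => ⟨fun h e he he' => ?_, fun h e he he' => h e (by omega) he'⟩
      rcases he.eq_or_lt with rfl | he
      · exact ⟨b', h₁⟩
      · exact h e (by omega) he'

/-- The end of a constant is the first position from `x` on without a bit, which again needs no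
recursion. -/
theorem add_length_constAt_eq (l : List (Letter σ)) (x z : ℕ) :
    x + (constAt l x).length = z ↔
      x ≤ z ∧ (∀ e, x ≤ e → e < z → ∃ b, l[e]? = some (Letter.bit b)) ∧
        ∀ b, l[z]? ≠ some (Letter.bit b) := by
  have key : (∀ e, x ≤ e → e < x + (constAt l x).length → ∃ b, l[e]? = some (Letter.bit b)) ∧
      ∀ b, l[x + (constAt l x).length]? ≠ some (Letter.bit b) := by
    induction h : constAt l x generalizing x with
    | nil =>
      exact ⟨fun e h₁ h₂ => by simp at h₂; omega, by simpa using (constAt_eq_nil l x).1 h⟩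
    | cons b c ih =>
      obtain ⟨h₁, h₂⟩ := (constAt_eq_cons l x b c).1 h
      obtain ⟨h₃, h₄⟩ := ih (x + 1) h₂
      rw [show x + 1 + c.length = x + (b :: c).length by simp; omega] at h₃ h₄
      refine ⟨fun e he he' => ?_, h₄⟩
      rcases he.eq_or_lt with rfl | he
      · exact ⟨b, h₁⟩
      · exact h₃ e (by omega) he'
  constructor
  · rintro rfl
    exact ⟨by omega, key⟩
  · rintro ⟨h₁, h₂, h₃⟩
    rcases lt_trichotomy (x + (constAt l x).length) z with h | h | h
    · obtain ⟨b, hb⟩ := h₂ _ (by omega) h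
      exact absurd hb (key.2 b)
    · exact h
    · obtain ⟨b, hb⟩ := key.1 _ h₁ h
      exact absurd hb (h₃ b)

/-- The encoding of a list of constants. -/
def encodeConsts (cs : List Const) : List (Letter σ) :=
  cs.flatMap fun b => Letter.sep :: b.map Letter.bit

/-- The word is empty or begins with a relation symbol. -/
def FactBoundary (l : List (Letter σ)) : Prop :=
  l = [] ∨ ∃ R t, l = Letter.rel R :: t

theorem FactBoundary.leadingBits {l : List (Letter σ)} (h : FactBoundary l) :
    leadingBits l = [] := by
  rcases h with rfl | ⟨R, t, rfl⟩ <;> rfl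

theorem leadingBits_encodeConsts (cs : List Const) {l : List (Letter σ)} (h : FactBoundary l) :
    leadingBits (encodeConsts cs ++ l) = [] := by
  cases cs with
  | nil => simpa [encodeConsts] using h.leadingBits
  | cons c cs => simp [encodeConsts, leadingBits]

/-- The constants `cs` are listed from position `x` up to a fact boundary. -/
def ConstsAt (l : List (Letter σ)) (x : ℕ) (cs : List Const) : Prop :=
  ∃ r, FactBoundary r ∧ l.drop x = encodeConsts cs ++ r

theorem factBoundary_drop (l : List (Letter σ)) (x : ℕ) :
    FactBoundary (l.drop x) ↔ l.length ≤ x ∨ ∃ R, l[x]? = some (Letter.rel R) := by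
  unfold FactBoundary
  rw [List.drop_eq_nil_iff]
  refine or_congr_right' fun h => exists_congr fun R => ?_
  rw [not_le] at h
  rw [List.drop_eq_getElem_cons h, List.getElem?_eq_getElem h]
  exact ⟨fun ⟨t, ht⟩ => congrArg some (List.cons.inj ht).1,
    fun h' => ⟨_, by rw [Option.some.inj h']⟩⟩

theorem constsAt_nil (l : List (Letter σ)) (x : ℕ) :
    ConstsAt l x [] ↔ l.length ≤ x ∨ ∃ R, l[x]? = some (Letter.rel R) := by
  rw [← factBoundary_drop]
  simp [ConstsAt, encodeConsts]

/-- This recursion lets a formula parse an argument list. The constant read is all of `c` because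
what follows it is a separator, a relation letter or the end, never a bit. -/
theorem constsAt_cons (l : List (Letter σ)) (x : ℕ) (c : Const) (cs : List Const) :
    ConstsAt l x (c :: cs) ↔ l[x]? = some Letter.sep ∧ constAt l (x + 1) = c ∧
      ConstsAt l (x + 1 + c.length) cs := by
  constructor
  · rintro ⟨r, hr, h⟩
    have h' : l.drop x = Letter.sep :: (c.map Letter.bit ++ (encodeConsts cs ++ r)) := by
      rw [h]; simp [encodeConsts]
    have h₁ : l.drop (x + 1) = c.map Letter.bit ++ (encodeConsts cs ++ r) := by
      rw [← List.drop_drop, h']; rfl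
    refine ⟨?_, ?_, r, hr, ?_⟩
    · have := congrArg (·[0]?) h'
      simpa using this
    · rw [constAt, h₁, leadingBits_map_append _ _ (leadingBits_encodeConsts cs hr)]
    · rw [← List.drop_drop, h₁, List.drop_left' (by simp)]
  · rintro ⟨h₁, rfl, r, hr, h₂⟩
    refine ⟨r, hr, ?_⟩
    obtain ⟨hx, h₁⟩ := List.getElem?_eq_some_iff.1 h₁
    rw [List.drop_eq_getElem_cons hx, h₁, ← map_leadingBits_append_drop (l.drop (x + 1)),
      List.drop_drop]
    change Letter.sep :: (List.map Letter.bit (constAt l (x + 1)) ++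
      List.drop (x + 1 + (constAt l (x + 1)).length) l) = _
    rw [h₂]
    simp [encodeConsts]

theorem ConstsAt.unique {l : List (Letter σ)} {x : ℕ} {cs cs' : List Const}
    (h : ConstsAt l x cs) (h' : ConstsAt l x cs') : cs = cs' := by
  induction cs generalizing x cs' with
  | nil =>
    cases cs' with
    | nil => rfl
    | cons c' cs' =>
      have h₁ := ((constsAt_cons _ _ _ _).1 h').1
      rcases (constsAt_nil _ _).1 h with h₂ | ⟨R, h₂⟩
      · simp [List.getElem?_eq_none h₂] at h₁
      · simp [h₂] at h₁
  | cons c cs ih =>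
    obtain ⟨h₁, h₂, h₃⟩ := (constsAt_cons _ _ _ _).1 h
    cases cs' with
    | nil =>
      rcases (constsAt_nil _ _).1 h' with h₂ | ⟨R, h₂⟩
      · simp [List.getElem?_eq_none h₂] at h₁
      · simp [h₂] at h₁
    | cons c' cs' =>
      obtain ⟨-, h₂', h₃'⟩ := (constsAt_cons _ _ _ _).1 h'
      obtain rfl := h₂.symm.trans h₂'
      rw [ih h₃ h₃']

theorem ConstsAt.exists_constAt {l : List (Letter σ)} {x : ℕ} {cs : List Const}
    (h : ConstsAt l x cs) {c : Const} (hc : c ∈ cs) : ∃ y ≤ l.length, constAt l y = c := by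
  induction cs generalizing x with
  | nil => simp at hc
  | cons c' cs ih =>
    obtain ⟨h₁, h₂, h₃⟩ := (constsAt_cons _ _ _ _).1 h
    rcases List.mem_cons.1 hc with rfl | hc
    -- The start may equal the length of the word, when its last constant is the empty string; hence
    -- positions range up to and including the length.
    · exact ⟨x + 1, (List.getElem?_eq_some_iff.1 h₁).1, h₂⟩
    · exact ih h₃ hc

/-- The fact `f` is written at position `p`. -/
def FactAt (l : List (Letter σ)) (p : ℕ) (f : Fact σ Const) : Prop :=
  l[p]? = some (Letter.rel f.rel) ∧ ConstsAt l (p + 1) (List.ofFn f.args)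

theorem factAt_iff (l : List (Letter σ)) (p : ℕ) (f : Fact σ Const) :
    FactAt l p f ↔ ∃ r, FactBoundary r ∧ l.drop p = encodeFact f ++ r := by
  constructor
  · rintro ⟨h, r, hr, h'⟩
    obtain ⟨hp, h⟩ := List.getElem?_eq_some_iff.1 h
    refine ⟨r, hr, ?_⟩
    rw [List.drop_eq_getElem_cons hp, h, h']
    rfl
  · rintro ⟨r, hr, h⟩
    refine ⟨?_, r, hr, ?_⟩
    · have := congrArg (·[0]?) h
      simpa [encodeFact] using this
    · rw [← List.drop_drop, h]
      rfl

theorem FactAt.unique {l : List (Letter σ)} {p : ℕ} {f g : Fact σ Const}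
    (hf : FactAt l p f) (hg : FactAt l p g) : f = g := by
  obtain ⟨R, c⟩ := f
  obtain ⟨R', c'⟩ := g
  obtain ⟨h₁, h₂⟩ := hf
  obtain ⟨h₁', h₂'⟩ := hg
  simp only at h₁ h₂ h₁' h₂'
  obtain rfl : R = R' := by simpa using h₁.symm.trans h₁'
  rw [List.ofFn_injective (h₂.unique h₂')]

theorem FactAt.exists_constAt {l : List (Letter σ)} {p : ℕ} {f : Fact σ Const}
    (hf : FactAt l p f) (i : Fin (σ.arity f.rel)) : ∃ y ≤ l.length, constAt l y = f.args i :=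
  hf.2.exists_constAt (List.mem_ofFn.2 ⟨i, rfl⟩)

/-! ### Locating facts in a concatenation of encodings -/

theorem factAt_append (s l : List (Letter σ)) (p : ℕ) (f : Fact σ Const) :
    FactAt (s ++ l) (s.length + p) f ↔ FactAt l p f := by
  rw [factAt_iff, factAt_iff, List.drop_length_add_append]

theorem factAt_cons_succ (a : Letter σ) (l : List (Letter σ)) (p : ℕ) (f : Fact σ Const) :
    FactAt (a :: l) (p + 1) f ↔ FactAt l p f := by
  simp [factAt_iff]

theorem factAt_length_add (s l : List (Letter σ)) (f : Fact σ Const) (h : FactBoundary l) :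
    FactAt (s ++ (encodeFact f ++ l)) s.length f :=
  (factAt_append s _ 0 f).2 ((factAt_iff _ _ _).2 ⟨l, h, rfl⟩)

theorem length_encodeFact_pos (f : Fact σ Const) : 0 < (encodeFact f).length := by
  simp [encodeFact]

theorem getElem?_encodeFact_succ (f : Fact σ Const) (p : ℕ) (R : σ.Rel) :
    (encodeFact f)[p + 1]? ≠ some (Letter.rel R) := by
  intro h
  have h' : (encodeConsts (List.ofFn f.args) : List (Letter σ))[p]? = some (Letter.rel R) := h
  simpa [encodeConsts] using List.mem_of_getElem? h'

theorem factBoundary_flatMap (fs : List (Fact σ Const)) :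
    FactBoundary (fs.flatMap encodeFact) := by
  cases fs with
  | nil => exact Or.inl rfl
  | cons f fs => exact Or.inr ⟨f.rel, _, rfl⟩

theorem getElem?_encodeFact_append (f : Fact σ Const) (l : List (Letter σ)) {p : ℕ} {R : σ.Rel}
    (h : (encodeFact f ++ l)[p]? = some (Letter.rel R)) (hp : p ≠ 0) :
    ∃ q, p = (encodeFact f).length + q ∧ l[q]? = some (Letter.rel R) := by
  obtain ⟨p, rfl⟩ := Nat.exists_eq_succ_of_ne_zero hp
  by_cases hp : p + 1 < (encodeFact f).length
  · rw [Nat.succ_eq_add_one, List.getElem?_append_left hp] at h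
    exact absurd h (getElem?_encodeFact_succ f p R)
  · obtain ⟨q, hq⟩ := Nat.exists_eq_add_of_le (not_lt.1 hp)
    refine ⟨q, hq, ?_⟩
    rw [Nat.succ_eq_add_one, hq, List.getElem?_append_right (by omega)] at h
    simpa using h

/-- Relation letters occur only at the start of an encoded fact, so each one marks an entry of the
list. -/
theorem exists_factAt_flatMap_of_rel (fs : List (Fact σ Const)) (p : ℕ) (R : σ.Rel)
    (h : (fs.flatMap encodeFact)[p]? = some (Letter.rel R)) :
    ∃ f ∈ fs, FactAt (fs.flatMap encodeFact) p f := by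
  induction fs generalizing p with
  | nil => simp at h
  | cons f fs ih =>
    rw [List.flatMap_cons] at h ⊢
    by_cases hp : p = 0
    · subst hp
      exact ⟨f, by simp, factAt_length_add [] _ f (factBoundary_flatMap fs)⟩
    · obtain ⟨q, rfl, hq⟩ := getElem?_encodeFact_append f _ h hp
      obtain ⟨g, hg, h'⟩ := ih _ hq
      exact ⟨g, by simp [hg], (factAt_append _ _ _ _).2 h'⟩

theorem mem_iff_exists_factAt (fs : List (Fact σ Const)) (f : Fact σ Const) :
    f ∈ fs ↔ ∃ p, FactAt (fs.flatMap encodeFact) p f := by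
  constructor
  · intro hf
    obtain ⟨s, t, rfl⟩ := List.append_of_mem hf
    rw [List.flatMap_append, List.flatMap_cons]
    exact ⟨_, factAt_length_add _ _ f (factBoundary_flatMap t)⟩
  · rintro ⟨p, h⟩
    obtain ⟨g, hg, h'⟩ := exists_factAt_flatMap_of_rel fs p _ h.1
    rwa [h.unique h']

/-- Every relation symbol begins a fact. -/
def WellFormed (l : List (Letter σ)) : Prop :=
  ∀ p R, l[p]? = some (Letter.rel R) → ∃ f, f.rel = R ∧ FactAt l p f

theorem wellFormed_flatMap (fs : List (Fact σ Const)) : WellFormed (fs.flatMap encodeFact) := by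
  intro p R hp
  obtain ⟨f, -, hf⟩ := exists_factAt_flatMap_of_rel fs p R hp
  exact ⟨f, by simpa [hp] using hf.1.symm, hf⟩

theorem WellFormed.of_append {s l : List (Letter σ)} (h : WellFormed (s ++ l)) :
    WellFormed l := by
  intro p R hp
  obtain ⟨f, hf, h'⟩ := h (s.length + p) R (by
    rw [List.getElem?_append_right (by omega)]; simpa using hp)
  exact ⟨f, hf, (factAt_append _ _ _ _).1 h'⟩

/-- The fact at position 0 ends at a boundary, and the remaining suffix inherits well-formedness, so
facts can be peeled off until the word is used up. No stray letters can remain between them. -/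
theorem WellFormed.exists_eq_flatMap {l : List (Letter σ)} (h : WellFormed l)
    (hl : FactBoundary l) : ∃ fs : List (Fact σ Const), l = fs.flatMap encodeFact := by
  induction hm : l.length using Nat.strong_induction_on generalizing l with
  | _ m ih =>
    rcases hl with rfl | ⟨R, t, rfl⟩
    · exact ⟨[], rfl⟩
    · obtain ⟨f, -, hf⟩ := h 0 R rfl
      obtain ⟨r, hr, hf⟩ := (factAt_iff _ _ _).1 hf
      rw [List.drop_zero] at hf
      rw [hf] at h hm ⊢
      have := length_encodeFact_pos f
      obtain ⟨fs, rfl⟩ := ih r.length (by simp at hm; omega) h.of_append hr rfl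
      exact ⟨f :: fs, by simp⟩

/-- Apart from the leading sign, an input is just a list of facts headed by the unsigned α. -/
theorem encodeSignedFact_append (α : SignedFact σ Const) (fs : List (Fact σ Const)) :
    encodeSignedFact α ++ fs.flatMap encodeFact =
      Letter.sign α.rel.1 :: ((⟨α.rel.2, α.args⟩ : Fact σ Const) :: fs).flatMap encodeFact := by
  rw [List.flatMap_cons]
  rfl

/-- Position 1 holds the fact underlying α, which need not be in the database; every other
occurrence of a fact comes from the list. -/
theorem mem_iff_exists_factAt_ne_one (α : SignedFact σ Const) (fs : List (Fact σ Const))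
    (f : Fact σ Const) :
    f ∈ fs ↔ ∃ p, p ≠ 1 ∧ FactAt (encodeSignedFact α ++ fs.flatMap encodeFact) p f := by
  rw [encodeSignedFact_append, mem_iff_exists_factAt]
  constructor
  · rintro ⟨p, hp⟩
    refine ⟨(encodeFact (⟨α.rel.2, α.args⟩ : Fact σ Const)).length + p + 1, ?_, ?_⟩
    · have := length_encodeFact_pos (⟨α.rel.2, α.args⟩ : Fact σ Const)
      omega
    · rwa [factAt_cons_succ, List.flatMap_cons, factAt_append]
  · rintro ⟨p, hp, h⟩
    rcases p with _ | p
    · simpa using h.1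
    · rw [factAt_cons_succ, List.flatMap_cons] at h
      obtain ⟨q, rfl, -⟩ := getElem?_encodeFact_append _ _ h.1 (by omega)
      exact ⟨q, (factAt_append _ _ _ _).1 h⟩

/-- Recognizing the words that encode a database and a signed fact. -/
theorem encodes_iff (l : List (Letter σ)) (D : Finset (Fact σ Const)) (α : SignedFact σ Const) :
    Encodes l D α ↔ l[0]? = some (Letter.sign α.rel.1) ∧ FactAt l 1 ⟨α.rel.2, α.args⟩ ∧
      WellFormed l ∧ ∀ f, f ∈ D ↔ ∃ p, p ≠ 1 ∧ FactAt l p f := by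
  constructor
  · rintro ⟨fs, hfs, rfl⟩
    refine ⟨rfl, ?_, ?_, fun f => by rw [← hfs, mem_iff_exists_factAt_ne_one α fs f]⟩
    · rw [encodeSignedFact_append, List.flatMap_cons]
      exact factAt_length_add [_] _ _ (factBoundary_flatMap fs)
    · rw [encodeSignedFact_append]
      intro p R hp
      rcases p with _ | p
      · simp at hp
      · obtain ⟨f, hf, h⟩ := wellFormed_flatMap _ p R hp
        exact ⟨f, hf, (factAt_cons_succ _ _ _ _).2 h⟩
  · rintro ⟨h₀, h₁, hwf, hD⟩
    obtain ⟨r, hr, h₁⟩ := (factAt_iff _ _ _).1 h₁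
    obtain ⟨hl, h₀⟩ := List.getElem?_eq_some_iff.1 h₀
    have e : l = encodeSignedFact α ++ r := by
      rw [← List.drop_zero (l := l), List.drop_eq_getElem_cons hl, h₀, h₁]
      rfl
    rw [e] at hwf
    obtain ⟨fs, rfl⟩ := hwf.of_append.exists_eq_flatMap hr
    refine ⟨fs, fun f => ?_, e⟩
    rw [hD, mem_iff_exists_factAt_ne_one α fs f, e]

end SignedRelevance

namespace SignedRelevance

/-! ### Relevance in terms of satisfying assignments -/

section Relevance

variable {σ : Schema} {C : Type}

/-- The signed facts to which an assignment maps the atoms of a query. -/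
def CQNeg.image (p : CQNeg σ C) (ν : Var → C) : Set (SignedFact σ C) :=
  {β | ∃ a ∈ p.signed.pos, β = groundAtom ν a}

/-- The assignment satisfies the inequalities of a query. -/
def CQNeg.SatIneq (p : CQNeg σ C) (ν : Var → C) : Prop :=
  ∀ e ∈ p.ineq, e.1.eval ν ≠ e.2.eval ν

theorem CQNeg.image_subset_iff (p : CQNeg σ C) (ν : Var → C) (S : Set (SignedFact σ C)) :
    p.image ν ⊆ S ↔ ∀ a ∈ p.signed.pos, groundAtom ν a ∈ S := by
  constructor
  · exact fun h a ha => h ⟨a, ha, rfl⟩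
  · rintro h β ⟨a, ha, rfl⟩
    exact h a ha

theorem holds_signed_iff (q : UCQNeg σ C) (S : Set (SignedFact σ C)) :
    UCQNeg.Holds (UCQNeg.signed q) S ↔ ∃ p ∈ q, ∃ ν, p.image ν ⊆ S ∧ p.SatIneq ν := by
  unfold UCQNeg.Holds UCQNeg.signed
  simp only [List.mem_map, exists_exists_and_eq_and]
  refine exists_congr fun p => and_congr_right fun _ => exists_congr fun ν => ?_
  rw [CQNeg.image_subset_iff]
  constructor
  · exact fun h => ⟨h.1, h.2.2⟩
  · exact fun h => ⟨h.1, by simp [CQNeg.signed], h.2⟩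

theorem groundAtom_congr {ν ν' : Var → C} {a : Atom σ C}
    (h : ∀ x, OccursIn x a → ν x = ν' x) : groundAtom ν a = groundAtom ν' a := by
  unfold groundAtom
  congr 1
  funext i
  rcases hi : a.args i with c | x
  · rfl
  · exact h x ⟨i, hi⟩

theorem CQNeg.image_congr (p : CQNeg σ C) {ν ν' : Var → C}
    (h : ∀ a ∈ p.signed.pos, ∀ x, OccursIn x a → ν x = ν' x) : p.image ν = p.image ν' := by
  ext β
  refine exists_congr fun a => and_congr_right fun ha => ?_
  rw [groundAtom_congr (h a ha)]

/-- Safety enters here: every variable of an inequality occurs in some atom, where the two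
assignments agree. -/
theorem CQNeg.satIneq_congr (p : CQNeg σ C) {ν ν' : Var → C}
    (h : ∀ a ∈ p.signed.pos, ∀ x, OccursIn x a → ν x = ν' x) (hν : p.SatIneq ν) :
    p.SatIneq ν' := by
  intro e he
  have key : ∀ x, e.1 = .var x ∨ e.2 = .var x → ν x = ν' x := fun x hx => by
    obtain ⟨a, ha, hx⟩ := p.signed.safe_ineq e he x hx
    exact h a ha x hx
  have h₁ : e.1.eval ν = e.1.eval ν' := by
    rcases h : e.1 with c | x
    · rfl
    · exact key x (Or.inl h)
  have h₂ : e.2.eval ν = e.2.eval ν' := by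
    rcases h : e.2 with c | x
    · rfl
    · exact key x (Or.inr h)
  rw [← h₁, ← h₂]
  exact hν e he

/-- Relevance, with assignments ranging over any set that contains, up to irrelevant changes, all
assignments into the signed database. -/
theorem isSignedRelevant_iff (q : UCQNeg σ C) (D : Finset (Fact σ C)) (α : SignedFact σ C)
    (V : Set (Var → C))
    (hV : ∀ p ∈ q, ∀ ν, p.image ν ⊆ signedDb D → ∃ ν' ∈ V,
      ∀ a ∈ p.signed.pos, ∀ x, OccursIn x a → ν x = ν' x) :
    IsSignedRelevant q D α ↔ ∃ p ∈ q, ∃ ν ∈ V, p.image ν ⊆ signedDb D ∧ p.SatIneq ν ∧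
      α ∈ p.image ν ∧ ∀ p' ∈ q, ∀ ν' ∈ V, p'.SatIneq ν' → p'.image ν' ⊆ p.image ν →
        p.image ν ⊆ p'.image ν' := by
  constructor
  · rintro ⟨S, ⟨⟨hS, hq⟩, hmin⟩, hα⟩
    obtain ⟨p, hp, ν, hν, hne⟩ := (holds_signed_iff q S).1 hq
    -- The image is itself a support contained in `S`, so minimality makes the two equal.
    have hle : S ⊆ p.image ν := hmin
      ⟨hν.trans hS, (holds_signed_iff _ _).2 ⟨p, hp, ν, subset_rfl, hne⟩⟩ hν
    obtain ⟨ν', hν'V, hag⟩ := hV p hp ν (hν.trans hS)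
    rw [p.image_congr hag] at hν hle
    refine ⟨p, hp, ν', hν'V, hν.trans hS, p.satIneq_congr hag hne, hle hα, ?_⟩
    intro p' hp' ν'' _ hne' hsub
    have h := hsub.trans hν
    exact hν.trans (hmin
      ⟨h.trans hS, (holds_signed_iff _ _).2 ⟨p', hp', ν'', subset_rfl, hne'⟩⟩ h)
  · rintro ⟨p, hp, ν, -, hν, hne, hα, hmin⟩
    refine ⟨p.image ν, ⟨⟨hν, (holds_signed_iff _ _).2 ⟨p, hp, ν, subset_rfl, hne⟩⟩, ?_⟩, hα⟩
    rintro S ⟨hS, hq⟩ hle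
    obtain ⟨p', hp', ν', hν', hne'⟩ := (holds_signed_iff q S).1 hq
    -- A competing support contains an image, and that image is again given by an assignment from
    -- `V`, to which the hypothesis on images applies.
    obtain ⟨ν'', hν''V, hag⟩ := hV p' hp' ν' (hν'.trans hS)
    rw [p'.image_congr hag] at hν'
    exact (hmin p' hp' ν'' hν''V (p'.satIneq_congr hag hne') (hν'.trans hle)).trans hν'

theorem args_mem_activeDomain {D : Finset (Fact σ C)} {β : SignedFact σ C}
    (hβ : β ∈ signedDb D) (i) : β.args i ∈ activeDomain (D : Set (Fact σ C)) := by
  rcases hβ with ⟨f, hf, rfl⟩ | ⟨f, hf, -, rfl⟩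
  · exact ⟨f, hf, i, rfl⟩
  · exact hf i

theorem mem_signedDb_iff (D : Finset (Fact σ C)) (β : SignedFact σ C) :
    β ∈ signedDb D ↔
      (β.rel.1 = true ∧ (⟨β.rel.2, β.args⟩ : Fact σ C) ∈ D) ∨
      (β.rel.1 = false ∧ (∀ i, β.args i ∈ activeDomain (D : Set (Fact σ C))) ∧
        (⟨β.rel.2, β.args⟩ : Fact σ C) ∉ D) := by
  obtain ⟨⟨s, R⟩, c⟩ := β
  constructor
  · rintro (⟨f, hf, h⟩ | ⟨f, hf, hf', h⟩)
    · cases h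
      exact Or.inl ⟨rfl, hf⟩
    · cases h
      exact Or.inr ⟨rfl, hf, hf'⟩
  · rintro (⟨rfl, h⟩ | ⟨rfl, h, h'⟩)
    · exact Or.inl ⟨_, h, rfl⟩
    · exact Or.inr ⟨⟨R, c⟩, h, h', rfl⟩

theorem exists_bound_of_forall_mem {β : Type*} (l : List β) (P : β → ℕ → Prop)
    (h : ∀ b, ∃ N, ∀ x, P b x → x < N) : ∃ N, ∀ b ∈ l, ∀ x, P b x → x < N := by
  induction l with
  | nil => exact ⟨0, by simp⟩
  | cons b l ih =>
    obtain ⟨N, hN⟩ := ih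
    obtain ⟨M, hM⟩ := h b
    refine ⟨max N M, fun b' hb' x hx => ?_⟩
    rcases List.mem_cons.1 hb' with rfl | hb'
    · exact lt_max_of_lt_right (hM x hx)
    · exact lt_max_of_lt_left (hN b' hb' x hx)

/-- The query is fixed and finite, so assignments can be represented by tuples of constant length.
-/
theorem exists_var_bound (q : UCQNeg σ C) :
    ∃ N, ∀ p ∈ q, ∀ a ∈ p.signed.pos, ∀ x, OccursIn x a → x < N := by
  obtain ⟨N, hN⟩ := exists_bound_of_forall_mem q
    (fun p x => ∃ a ∈ p.signed.pos, OccursIn x a) fun p => by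
      obtain ⟨N, hN⟩ := exists_bound_of_forall_mem p.signed.pos (fun a x => OccursIn x a)
        fun a => by
          obtain ⟨N, hN⟩ := exists_bound_of_forall_mem (List.finRange (σ.signed.arity a.rel))
            (fun i x => a.args i = .var x) fun i => by
              rcases a.args i with c | y
              · exact ⟨0, by simp⟩
              · exact ⟨y + 1, fun x hx => by cases hx; omega⟩
          exact ⟨N, fun x ⟨i, hi⟩ => hN i (List.mem_finRange i) x hi⟩
      exact ⟨N, fun x ⟨a, ha, hx⟩ => hN a ha x hx⟩
  exact ⟨N, fun p hp a ha x hx => hN p hp x ⟨a, ha, hx⟩⟩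

end Relevance

/-! ### Definability of the decision problem -/

variable {σ : Schema} {ι : Type}

namespace Definable

open Letter

theorem isBit (i : ι) : Definable fun n (w : Fin n → Letter σ) v =>
    ∃ b, (List.ofFn w)[(v i : ℕ)]? = some (bit b) :=
  existsFinite fun b => getElem? (bit b) i

theorem isBitBetween (i j : ι) : Definable fun n (w : Fin n → Letter σ) v =>
    ∀ e, (v i : ℕ) ≤ e → e < v j → ∃ b, (List.ofFn w)[e]? = some (bit b) := by
  refine (all (P := fun n w v (e : Fin (n + 1)) => (v i : ℕ) ≤ e → (e : ℕ) < v j →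
    ∃ b, (List.ofFn w)[(e : ℕ)]? = some (bit b))
    ((le (some i) none).imp ((lt none (some j)).imp (isBit none)))).congr fun n w v => ?_
  constructor
  · intro h e h₁ h₂
    exact h ⟨e, by omega⟩ h₁ h₂
  · exact fun h e => h e

theorem addLengthConstAt (i j : ι) : Definable fun n (w : Fin n → Letter σ) v =>
    (v i : ℕ) + (constAt (List.ofFn w) (v i)).length = v j := by
  refine ((le i j).and ((isBitBetween i j).and (isBit j).not)).congr fun n w v => ?_
  rw [add_length_constAt_eq, not_exists]

theorem getElem?_constAt (i d : ι) (b : Bool) : Definable fun n (w : Fin n → Letter σ) v =>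
    (constAt (List.ofFn w) (v i))[(v d : ℕ)]? = some b := by
  refine (ex (P := fun n w v (z : Fin (n + 1)) => (v i : ℕ) + v d = z ∧
    (∀ e, (v i : ℕ) ≤ e → e < z → ∃ b, (List.ofFn w)[e]? = some (bit b)) ∧
    (List.ofFn w)[(z : ℕ)]? = some (bit b))
    ((add (some i) (some d) none).and ((isBitBetween (some i) none).and
      (getElem? (bit b) none)))).congr fun n w v => ?_
  rw [SignedRelevance.getElem?_constAt]
  constructor
  · rintro ⟨z, h, h'⟩
    rwa [h]
  · intro h
    have hlt : (v i : ℕ) + v d < n := by simpa using (List.getElem?_eq_some_iff.1 h.2).1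
    exact ⟨⟨v i + v d, by omega⟩, rfl, h⟩

/-- Bit strings are equal when they agree at every offset. -/
theorem constAt_eq_constAt (i j : ι) : Definable fun n (w : Fin n → Letter σ) v =>
    constAt (List.ofFn w) (v i) = constAt (List.ofFn w) (v j) := by
  refine (all (P := fun n w v (d : Fin (n + 1)) => ∀ b : Bool,
    (constAt (List.ofFn w) (v i))[(d : ℕ)]? = some b ↔
      (constAt (List.ofFn w) (v j))[(d : ℕ)]? = some b)
    (forallFinite fun b => (getElem?_constAt (some i) none b).iff
      (getElem?_constAt (some j) none b))).congr fun n w v => ?_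
  constructor
  · intro h
    apply List.ext_getElem?
    intro d
    by_cases hd : d < n + 1
    · exact Option.ext (h ⟨d, hd⟩)
    -- Constants read from the word have length at most `n`, so at larger offsets both sides read
    -- nothing and offsets up to `n` suffice.
    · have key : ∀ x, (constAt (List.ofFn w) x).length ≤ d := fun x => by
        refine (length_leadingBits_le _).trans ?_
        simp only [List.length_drop, List.length_ofFn]
        omega
      rw [List.getElem?_eq_none (key _), List.getElem?_eq_none (key _)]
  · intro h d b
    rw [h]

theorem constAt_eq_const (i : ι) (c : Const) : Definable fun n (w : Fin n → Letter σ) v =>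
    constAt (List.ofFn w) (v i) = c := by
  induction c generalizing ι with
  | nil =>
    refine (isBit i).not.congr fun n w v => ?_
    rw [constAt_eq_nil, not_exists]
  | cons b c ih =>
    refine ((getElem? (bit b) i).and (ex (P := fun n w v (y : Fin (n + 1)) =>
      (y : ℕ) = v i + 1 ∧ constAt (List.ofFn w) y = c)
      ((eqSucc none (some i)).and (ih none)))).congr fun n w v => ?_
    rw [constAt_eq_cons]
    refine and_congr_right fun h => ?_
    have hlt : (v i : ℕ) < n := by simpa using (List.getElem?_eq_some_iff.1 h).1
    constructor
    · rintro ⟨y, hy, h'⟩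
      rwa [← hy]
    · exact fun h' => ⟨⟨v i + 1, by omega⟩, rfl, h'⟩

end Definable

/-- A constant that depends on a word and positions in it: fixed, or read from a position. -/
inductive IsTerm : (∀ n : ℕ, (Fin n → Letter σ) → (ι → Fin (n + 1)) → Const) → Prop
  | const (c : Const) : IsTerm fun _ _ _ => c
  | read (i : ι) : IsTerm fun _ w v => constAt (List.ofFn w) (v i)

namespace IsTerm

variable {F G : ∀ n : ℕ, (Fin n → Letter σ) → (ι → Fin (n + 1)) → Const}

theorem comp {κ : Type} (hF : IsTerm F) (f : ι → κ) :
    IsTerm fun n w (v : κ → Fin (n + 1)) => F n w fun i => v (f i) := by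
  cases hF with
  | const c => exact const c
  | read i => exact read (f i)

theorem eval (t : QTerm Const) (e : Var → ι) :
    IsTerm fun n (w : Fin n → Letter σ) (v : ι → Fin (n + 1)) =>
      t.eval fun x => constAt (List.ofFn w) (v (e x)) := by
  cases t with
  | const c => exact const c
  | var x => exact read (e x)

theorem definable_eq (hF : IsTerm F) (hG : IsTerm G) :
    Definable fun n w v => F n w v = G n w v := by
  cases hF with
  | const c =>
    cases hG with
    | const c' => exact .const _
    | read j => exact (Definable.constAt_eq_const j c).congr fun n w v => eq_comm
  | read i =>
    cases hG with
    | const c => exact .constAt_eq_const i c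
    | read j => exact .constAt_eq_constAt i j

end IsTerm

/-! ### Defining the facts written in a word -/

namespace Definable

/-- Each list entry costs two quantified positions: `y`, where its bits start, and `z`, where they
end and the rest of the list begins. The length of the list is fixed, so the formula is finite. -/
theorem constsAt (x : ι) (Fs : List (∀ n : ℕ, (Fin n → Letter σ) → (ι → Fin (n + 1)) → Const))
    (hF : ∀ F ∈ Fs, IsTerm F) :
    Definable fun n w v => ConstsAt (List.ofFn w) (v x) (Fs.map fun F => F n w v) := by
  have := σ.finite_rel
  induction hm : Fs.length generalizing ι with
  | zero =>
    obtain rfl := List.length_eq_zero_iff.1 hm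
    refine ((arith (UniformlyDefinable.lt_last x)).not.or
      (existsFinite fun R => getElem? (Letter.rel R) x)).congr fun n w v => ?_
    rw [List.map_nil, constsAt_nil, List.length_ofFn, not_lt]
  | succ m ih =>
    obtain ⟨F, Fs, rfl⟩ := List.exists_cons_of_length_eq_add_one hm
    have hrec := @ih (Option (Option ι)) none
      (Fs.map fun F n w v => F n w fun i => v (some (some i))) (by
        intro F' hF'
        obtain ⟨F, hF₁, rfl⟩ := List.mem_map.1 hF'
        exact (hF F (List.mem_cons_of_mem _ hF₁)).comp _) (by simpa using hm)
    refine ((getElem? Letter.sep x).and (ex (P := fun n w v (y : Fin (n + 1)) =>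
      (y : ℕ) = v x + 1 ∧ constAt (List.ofFn w) y = F n w v ∧ ∃ z : Fin (n + 1),
        (y : ℕ) + (constAt (List.ofFn w) y).length = z ∧
          ConstsAt (List.ofFn w) z (Fs.map fun F => F n w v))
      ((eqSucc none (some x)).and (((IsTerm.read none).definable_eq
        ((hF F List.mem_cons_self).comp some)).and
        (ex (P := fun n w v (z : Fin (n + 1)) =>
          (v none : ℕ) + (constAt (List.ofFn w) (v none)).length = z ∧
            ConstsAt (List.ofFn w) z (Fs.map fun F => F n w fun i => v (some i)))
          ((addLengthConstAt (some none) none).and (hrec.congr fun n w v => by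
            rw [List.map_map]; rfl))))))).congr fun n w v => ?_
    rw [List.map_cons, constsAt_cons]
    refine and_congr_right fun h => ?_
    have hlt : (v x : ℕ) < n := by simpa using (List.getElem?_eq_some_iff.1 h).1
    constructor
    · rintro ⟨y, hy, h₁, z, h₂, h₃⟩
      rw [← hy, ← h₁, h₂]
      exact ⟨rfl, h₃⟩
    · rintro ⟨h₁, h₂⟩
      rw [← h₁] at h₂ ⊢
      have hle := length_leadingBits_le ((List.ofFn w).drop (v x + 1))
      simp only [List.length_drop, List.length_ofFn] at hle
      exact ⟨⟨v x + 1, by omega⟩, rfl, rfl,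
        ⟨v x + 1 + (constAt (List.ofFn w) (v x + 1)).length, by unfold constAt; omega⟩, rfl, h₂⟩

theorem factAt (x : ι) (R : σ.Rel)
    (F : Fin (σ.arity R) → ∀ n : ℕ, (Fin n → Letter σ) → (ι → Fin (n + 1)) → Const)
    (hF : ∀ j, IsTerm (F j)) :
    Definable fun n w v => FactAt (List.ofFn w) (v x) ⟨R, fun j => F j n w v⟩ := by
  refine ((getElem? (Letter.rel R) x).and (ex (P := fun n w v (y : Fin (n + 1)) =>
    (y : ℕ) = v x + 1 ∧ ConstsAt (List.ofFn w) y (List.ofFn fun j => F j n w v))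
    ((eqSucc none (some x)).and ((constsAt none
      (List.ofFn fun j n w v => F j n w fun i => v (some i)) (by
        intro G hG
        obtain ⟨j, rfl⟩ := List.mem_ofFn.1 hG
        exact (hF j).comp some)).congr fun n w v => by
          rw [List.map_ofFn]; rfl)))).congr fun n w v => ?_
  refine and_congr_right fun h => ?_
  have hlt : (v x : ℕ) < n := by simpa using (List.getElem?_eq_some_iff.1 h).1
  constructor
  · rintro ⟨y, hy, h'⟩
    rwa [hy] at h'
  · exact fun h' => ⟨⟨v x + 1, by omega⟩, rfl, h'⟩

end Definable

/-- The fact is listed in the database part of a word. -/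
def Listed (l : List (Letter σ)) (f : Fact σ Const) : Prop :=
  ∃ p, p ≠ 1 ∧ FactAt l p f

/-- Each of the finitely many positions begins at most one fact. This supplies the database when a
word has been recognized as well-formed. -/
theorem finite_setOf_listed (l : List (Letter σ)) : {f | Listed l f}.Finite := by
  refine ((Set.finite_lt_nat l.length).biUnion (t := fun p => {f | FactAt l p f})
    fun p _ => Set.Subsingleton.finite fun f hf g hg => FactAt.unique hf hg).subset ?_
  rintro f ⟨p, -, hp⟩
  exact Set.mem_biUnion (List.getElem?_eq_some_iff.1 hp.1).1 hp

/-- The arguments of a written fact can be read off the word, so quantification over their values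
may be replaced by quantification over positions. -/
theorem FactAt.exists_positions {n : ℕ} {w : Fin n → Letter σ} {p : ℕ} {R : σ.Rel}
    {args : Fin (σ.arity R) → Const} (h : FactAt (List.ofFn w) p ⟨R, args⟩) :
    ∃ u : Fin (σ.arity R) → Fin (n + 1), (fun j => constAt (List.ofFn w) (u j)) = args := by
  have key : ∀ j, ∃ y : Fin (n + 1), constAt (List.ofFn w) y = args j := fun j => by
    obtain ⟨y, hy, h⟩ := h.exists_constAt j
    rw [List.length_ofFn] at hy
    exact ⟨⟨y, by omega⟩, h⟩
  choose u hu using key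
  exact ⟨u, funext hu⟩

namespace Definable

theorem listed (R : σ.Rel)
    (F : Fin (σ.arity R) → ∀ n : ℕ, (Fin n → Letter σ) → (ι → Fin (n + 1)) → Const)
    (hF : ∀ j, IsTerm (F j)) :
    Definable fun n w v => Listed (List.ofFn w) ⟨R, fun j => F j n w v⟩ := by
  refine (ex (P := fun n w v (p : Fin (n + 1)) => (p : ℕ) ≠ 1 ∧
    FactAt (List.ofFn w) p ⟨R, fun j => F j n w v⟩)
    ((eqConst none 1).not.and (factAt none R (fun j n w v => F j n w fun i => v (some i))
      fun j => (hF j).comp some))).congr fun n w v => ?_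
  constructor
  · rintro ⟨p, h⟩
    exact ⟨p, h⟩
  · rintro ⟨p, h⟩
    have hlt : p < n := by simpa using (List.getElem?_eq_some_iff.1 h.2.1).1
    exact ⟨⟨p, by omega⟩, h⟩

theorem occursInListed {F : ∀ n : ℕ, (Fin n → Letter σ) → (ι → Fin (n + 1)) → Const}
    (hF : IsTerm F) :
    Definable fun n w v => F n w v ∈ activeDomain {f | Listed (List.ofFn w) f} := by
  have := σ.finite_rel
  refine (existsFinite fun R : σ.Rel =>
    exTuple (k := σ.arity R) (P := fun n w v u =>
      Listed (List.ofFn w) ⟨R, fun j => constAt (List.ofFn w) (u j)⟩ ∧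
        ∃ j, constAt (List.ofFn w) (u j) = F n w v)
    ((listed R (fun j n w v => constAt (List.ofFn w) (v (Sum.inr j)))
      fun j => IsTerm.read _).and
      (existsFinite fun j => (IsTerm.read (Sum.inr j)).definable_eq (hF.comp Sum.inl)))).congr
    fun n w v => ?_
  constructor
  · rintro ⟨R, u, h, j, h'⟩
    exact ⟨_, h, j, h'⟩
  · rintro ⟨⟨R, c⟩, hf, j, h⟩
    obtain ⟨u, rfl⟩ := hf.choose_spec.2.exists_positions
    exact ⟨R, u, hf, j, h⟩

theorem groundAtom_eq {τ : Schema} (a : Atom τ Const) (e : Var → ι) (R : τ.Rel)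
    (F : Fin (τ.arity R) → ∀ n : ℕ, (Fin n → Letter σ) → (ι → Fin (n + 1)) → Const)
    (hF : ∀ j, IsTerm (F j)) :
    Definable fun n (w : Fin n → Letter σ) v =>
      (⟨R, fun j => F j n w v⟩ : Fact τ Const) =
        groundAtom (fun x => constAt (List.ofFn w) (v (e x))) a := by
  obtain ⟨R', args⟩ := a
  by_cases h : R = R'
  · subst h
    refine (forallFinite fun j => (hF j).definable_eq (IsTerm.eval (args j) e)).congr
      fun n w v => ?_
    simp [groundAtom, funext_iff]
  · refine (const False).congr fun n w v => ?_
    simp [groundAtom, h]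

theorem wellFormed : Definable fun n (w : Fin n → Letter σ) (_ : ι → Fin (n + 1)) =>
    WellFormed (List.ofFn w) := by
  have := σ.finite_rel
  refine (forallFinite fun R : σ.Rel =>
    all (P := fun n w v (p : Fin (n + 1)) => (List.ofFn w)[(p : ℕ)]? = some (Letter.rel R) →
      ∃ u : Fin (σ.arity R) → Fin (n + 1), FactAt (List.ofFn w) p
        ⟨R, fun j => constAt (List.ofFn w) (u j)⟩)
    ((getElem? (Letter.rel R) none).imp (exTuple (P := fun n w v u =>
      FactAt (List.ofFn w) (v none) ⟨R, fun j => constAt (List.ofFn w) (u j)⟩)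
      (factAt _ R (fun j n w v => constAt (List.ofFn w) (v (Sum.inr j)))
        fun j => IsTerm.read _)))).congr fun n w v => ?_
  constructor
  · intro h p R hp
    have hlt : p < n := by simpa using (List.getElem?_eq_some_iff.1 hp).1
    obtain ⟨u, hu⟩ := h R ⟨p, by omega⟩ hp
    exact ⟨_, rfl, hu⟩
  · intro h R p hp
    obtain ⟨⟨R, c⟩, rfl, hf⟩ := h p R hp
    obtain ⟨u, rfl⟩ := hf.exists_positions
    exact ⟨u, hf⟩

end Definable

/-- The assignment that reads the value of `x` from the position `u x`. -/
def readAssignment {n : ℕ} (w : Fin n → Letter σ) (u : Var → Fin (n + 1)) (x : Var) : Const :=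
  constAt (List.ofFn w) (u x)

/-- The signed facts of the database listed in a word. -/
def listedSignedDb (l : List (Letter σ)) : Set (SignedFact σ Const) :=
  {β | (β.rel.1 = true ∧ Listed l ⟨β.rel.2, β.args⟩) ∨
    (β.rel.1 = false ∧ (∀ i, β.args i ∈ activeDomain {f | Listed l f}) ∧
      ¬ Listed l ⟨β.rel.2, β.args⟩)}

theorem signedDb_eq_listedSignedDb {l : List (Letter σ)} {D : Finset (Fact σ Const)}
    (hD : ∀ f, f ∈ D ↔ Listed l f) : signedDb D = listedSignedDb l := by
  ext β
  have : (D : Set (Fact σ Const)) = {f | Listed l f} := Set.ext hD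
  rw [mem_signedDb_iff, this, hD]
  rfl

namespace Definable

theorem satIneq (p : CQNeg σ Const) (e : Var → ι) :
    Definable fun n (w : Fin n → Letter σ) v => p.SatIneq (readAssignment w fun x => v (e x)) :=
  forallMem _ fun c => ((IsTerm.eval c.1 e).definable_eq (IsTerm.eval c.2 e)).not

theorem mem_image (p : CQNeg σ Const) (e : Var → ι) (R : σ.signed.Rel)
    (F : Fin (σ.signed.arity R) → ∀ n : ℕ, (Fin n → Letter σ) → (ι → Fin (n + 1)) → Const)
    (hF : ∀ j, IsTerm (F j)) :
    Definable fun n (w : Fin n → Letter σ) v =>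
      (⟨R, fun j => F j n w v⟩ : SignedFact σ Const) ∈
        p.image (readAssignment w fun x => v (e x)) :=
  existsMem _ fun a => groundAtom_eq a e R F hF

theorem image_subset_image (p p' : CQNeg σ Const) (e e' : Var → ι) :
    Definable fun n (w : Fin n → Letter σ) v =>
      p.image (readAssignment w fun x => v (e x)) ⊆
        p'.image (readAssignment w fun x => v (e' x)) :=
  (forallMem p.signed.pos fun a => mem_image p' e' a.rel
    (fun j _ w v => (a.args j).eval (readAssignment w fun x => v (e x)))
    fun j => IsTerm.eval (a.args j) e).congr fun _ _ _ => (p.image_subset_iff _ _).symm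

theorem image_subset_listedSignedDb (p : CQNeg σ Const) (e : Var → ι) :
    Definable fun n (w : Fin n → Letter σ) v =>
      p.image (readAssignment w fun x => v (e x)) ⊆ listedSignedDb (List.ofFn w) := by
  refine (forallMem p.signed.pos (P := fun a n w v =>
    groundAtom (readAssignment w fun x => v (e x)) a ∈ listedSignedDb (List.ofFn w))
    fun a => ?_).congr fun n w v => (p.image_subset_iff _ _).symm
  obtain ⟨⟨s, R⟩, args⟩ := a
  have h := listed R (fun j n w v => (args j).eval (readAssignment w fun x => v (e x)))
    fun j => IsTerm.eval (args j) e
  -- The sign of an atom is part of the fixed query, so the choice between the two cases is a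
  -- constant formula.
  exact ((const (s = true)).and h).or ((const (s = false)).and ((forallFinite fun j =>
    occursInListed (IsTerm.eval (args j) e)).and h.not))

end Definable

/-- The index of a variable among the first `N + 1` variables. -/
def varIndex (N : ℕ) (x : Var) : Fin (N + 1) := Fin.ofNat (N + 1) x

theorem exists_readAssignment {n : ℕ} (w : Fin n → Letter σ) (D : Finset (Fact σ Const))
    (hD : ∀ f, f ∈ D ↔ Listed (List.ofFn w) f) (N : ℕ) (p : CQNeg σ Const)
    (hN : ∀ a ∈ p.signed.pos, ∀ x, OccursIn x a → x < N) (ν : Var → Const)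
    (hν : p.image ν ⊆ signedDb D) :
    ∃ u : Fin (N + 1) → Fin (n + 1), ∀ a ∈ p.signed.pos, ∀ x, OccursIn x a →
      ν x = readAssignment w (fun x => u (varIndex N x)) x := by
  classical
  -- Variables that occur in `p` take values in the active domain, which are written in the word.
  -- The default 0 serves values written nowhere and is never used for an occurring variable.
  refine ⟨fun j => if h : ∃ y : Fin (n + 1), constAt (List.ofFn w) y = ν j then h.choose else 0,
    fun a ha x hx => ?_⟩
  -- `varIndex` reduces modulo `N + 1`, which keeps the index type nonempty even for `N = 0` and
  -- changes no variable below `N`.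
  have hxN : ((varIndex N x : Fin (N + 1)) : ℕ) = x :=
    Nat.mod_eq_of_lt ((hN a ha x hx).trans (Nat.lt_succ_self N))
  obtain ⟨i, hi⟩ := hx
  obtain ⟨f, hf, j, h⟩ := args_mem_activeDomain (hν ⟨a, ha, rfl⟩) i
  obtain ⟨q, -, hq⟩ := (hD f).1 hf
  obtain ⟨y, hy, hy'⟩ := hq.exists_constAt j
  rw [List.length_ofFn] at hy
  have hνx : f.args j = ν x := by
    rw [h]
    change (a.args i).eval ν = ν x
    rw [hi]
    rfl
  have hex : ∃ y : Fin (n + 1), constAt (List.ofFn w) y = ν (varIndex N x : Fin (N + 1)) :=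
    ⟨⟨y, by omega⟩, by rw [hxN, ← hνx]; exact hy'⟩
  simp only [readAssignment]
  rw [dif_pos hex, hex.choose_spec, hxN]

/-- The first-order characterization of the decision problem. -/
theorem mem_signedRelevanceProblem_iff (q : UCQNeg σ Const) (N : ℕ)
    (hN : ∀ p ∈ q, ∀ a ∈ p.signed.pos, ∀ x, OccursIn x a → x < N) {n : ℕ}
    (w : Fin n → Letter σ) :
    List.ofFn w ∈ signedRelevanceProblem q ↔
      WellFormed (List.ofFn w) ∧ ∃ (s : Bool) (R : σ.Rel) (c : Fin (σ.arity R) → Fin (n + 1)),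
        (List.ofFn w)[0]? = some (Letter.sign s) ∧
        FactAt (List.ofFn w) 1 ⟨R, fun j => constAt (List.ofFn w) (c j)⟩ ∧
        ∃ p ∈ q, ∃ u : Fin (N + 1) → Fin (n + 1),
          p.image (readAssignment w fun x => u (varIndex N x)) ⊆ listedSignedDb (List.ofFn w) ∧
          p.SatIneq (readAssignment w fun x => u (varIndex N x)) ∧
          (⟨(s, R), fun j => constAt (List.ofFn w) (c j)⟩ : SignedFact σ Const) ∈
            p.image (readAssignment w fun x => u (varIndex N x)) ∧
          ∀ p' ∈ q, ∀ u' : Fin (N + 1) → Fin (n + 1),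
            p'.SatIneq (readAssignment w fun x => u' (varIndex N x)) →
            p'.image (readAssignment w fun x => u' (varIndex N x)) ⊆
              p.image (readAssignment w fun x => u (varIndex N x)) →
            p.image (readAssignment w fun x => u (varIndex N x)) ⊆
              p'.image (readAssignment w fun x => u' (varIndex N x)) := by
  have key : ∀ (D : Finset (Fact σ Const)) (α : SignedFact σ Const),
      (∀ f, f ∈ D ↔ Listed (List.ofFn w) f) → _ := fun D α hD =>
    -- The assignments read from positions may also yield junk, such as proper suffixes of
    -- constants. This is harmless, since the chosen set only has to cover the assignments into D±.
    isSignedRelevant_iff q D α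
      (Set.range fun (u : Fin (N + 1) → Fin (n + 1)) => readAssignment w fun x => u (varIndex N x))
      (fun p hp ν hν => by
        obtain ⟨u, hu⟩ := exists_readAssignment w D hD N p (hN p hp) ν hν
        exact ⟨_, ⟨u, rfl⟩, hu⟩)
  simp only [Set.exists_range_iff, Set.forall_mem_range] at key
  constructor
  · rintro ⟨D, ⟨⟨s, R⟩, args⟩, henc, hrel⟩
    obtain ⟨h₀, h₁, hwf, hD⟩ := (encodes_iff _ _ _).1 henc
    rw [key D _ hD, signedDb_eq_listedSignedDb hD] at hrel
    obtain ⟨c, rfl⟩ := FactAt.exists_positions (σ := σ) (R := R) (args := args) h₁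
    exact ⟨hwf, s, R, c, h₀, h₁, hrel⟩
  · rintro ⟨hwf, s, R, c, h₀, h₁, hrel⟩
    have hD : ∀ f, f ∈ (finite_setOf_listed (List.ofFn w)).toFinset ↔ Listed (List.ofFn w) f :=
      fun f => by simp
    refine ⟨_, ⟨(s, R), fun j => constAt (List.ofFn w) (c j)⟩,
      (encodes_iff _ _ _).2 ⟨h₀, h₁, hwf, hD⟩, ?_⟩
    rw [key _ _ hD, signedDb_eq_listedSignedDb hD]
    exact hrel

theorem definable_signedRelevanceProblem (q : UCQNeg σ Const) :
    Definable fun n (w : Fin n → Letter σ) (_ : Empty → Fin (n + 1)) =>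
      List.ofFn w ∈ signedRelevanceProblem q := by
  have := σ.finite_rel
  obtain ⟨N, hN⟩ := exists_var_bound q
  refine Definable.congr ?_ fun n w v => (mem_signedRelevanceProblem_iff q N hN w).symm
  refine Definable.wellFormed.and (.existsFinite fun s => .existsFinite fun R => .exTuple ?_)
  refine (Definable.getElem?_const _ 0).and (.and ?_ (.existsMem q fun p => .exTuple ?_))
  -- `Definable.factAt` needs a variable for the position, so the fixed position 1 is first named by
  -- a quantified `y`.
  · refine (Definable.ex (P := fun n w v (y : Fin (n + 1)) => (y : ℕ) = 1 ∧
      FactAt (List.ofFn w) y ⟨R, fun j => constAt (List.ofFn w) (v (Sum.inr j))⟩)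
      ((Definable.eqConst none 1).and (.factAt none R _ fun j => IsTerm.read _))).congr
      fun n w v => ?_
    constructor
    · rintro ⟨y, hy, h⟩
      rwa [hy] at h
    · intro h
      have hlt : 1 < n := by simpa using (List.getElem?_eq_some_iff.1 h.1).1
      exact ⟨⟨1, by omega⟩, rfl, h⟩
  · refine (Definable.image_subset_listedSignedDb p fun x => Sum.inr (varIndex N x)).and
      ((Definable.satIneq p fun x => Sum.inr (varIndex N x)).and
        ((Definable.mem_image p (fun x => Sum.inr (varIndex N x)) (s, R)
          (fun j n w v => constAt (List.ofFn w) (v (Sum.inl (Sum.inr j))))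
          fun j => IsTerm.read _).and (.forallMem q fun p' => .allTuple ?_)))
    exact (Definable.satIneq p' fun x => Sum.inr (varIndex N x)).imp
      ((Definable.image_subset_image p' p (fun x => Sum.inr (varIndex N x))
        fun x => Sum.inl (Sum.inr (varIndex N x))).imp
        (Definable.image_subset_image p p' (fun x => Sum.inl (Sum.inr (varIndex N x)))
          fun x => Sum.inr (varIndex N x)))

end SignedRelevance

theorem mainTheorem6 (σ : SignedRelevance.Schema)
    (q : SignedRelevance.UCQNeg σ SignedRelevance.Const) :
    SignedRelevance.InAC0 (SignedRelevance.signedRelevanceProblem q) := by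
  exact (SignedRelevance.definable_signedRelevanceProblem q).inAC0
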